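/- Let $d\ge 0$, $A=\mathbb{Q}[x_1,\dots,x_d]/\mathfrak m^2$ with $\mathfrak m=(x_1,\dots,x_d)$. The cyclic homology of $A$ over $\mathbb Q$ is the homology of the total complex of the Tsygan double complex, which has $A^{\otimes q+1}$ in position $(p,q)$, $p,q\ge 0$; its even columns are the Hochschild complex $(A^{\otimes *+1},b)$, its odd columns are the bar complex $(A^{\otimes *+1},b')$, and its horizontal maps are $1-t$ (from odd to even columns) and $N=1+t+\dots+t^q$ (from even to odd columns), where $t(a_0\otimes\cdots\otimes a_q)=(-1)^q a_q\otimes a_0\otimes\cdots\otimes a_{q-1}$. All these maps preserve the weight of a tensor monomial in $1,x_1,\dots,x_d$, i.e. the number of tensor factors lying in $\{x_1,\dots,x_d\}$; for $w\ge 0$ let $HC_n^{(w)}(A)$ be the $n$-th homology of the subcomplex of the total complex formed by the elements of weight $w$. For $m\geq 1$ let $T$ be the rotation of words of length $m$ in the letters $x_1,\dots,x_d$ that moves the last letter to the front. The cycle length of a word $v$ is the least $r>0$ with $T^r v=v$, and its cycle family is $\{T^r v: r\ge 0\}$. Let $\omega_{m,d}$ be the set of all cycle families of words of length $m$ and cycle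 length $m$. Then, as $\mathbb{Q}$-vector spaces, $$HC_n^{(0)}(A)\cong\begin{cases}\mathbb Q & n\ge 0 \text{ even},\\ 0&\text{else,}\end{cases}$$ and for every $w>0$ $$HC_n^{(w)}(A)\cong\begin{cases}\displaystyle\bigoplus_{\substack{m\mid w\\ m\equiv w \bmod 2}}\ \bigoplus_{\omega_{m,d}}\mathbb Q & n=w-1,\\ 0&\text{else.}\end{cases}$$ Moreover, for every $m\ge 1$ the set $\omega_{m,d}$ is finite and, with $\mu$ the Möbius function, $$|\omega_{m,d}|=\frac1m\sum_{i\mid m}\mu(m/i)\,d^{\,i}.$$ -/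

import Mathlib

open scoped TensorProduct DirectSum

namespace Tsygan

universe u v

section General

variable (k : Type u) [CommRing k] (A : Type v) [Ring A] [Algebra k A]

/-- The `k`-module `A ⊗ ⋯ ⊗ A` with `n + 1` tensor factors `a₀, …, aₙ`. -/
abbrev Chain (n : ℕ) : Type _ := ⨂[k] _ : Fin (n + 1), A

variable {A} in
/-- The entries of the `i`-th face of `(a₀, …, aₙ₊₁)`: for `i ≤ n` this is
`(a₀, …, aᵢ * aᵢ₊₁, …, aₙ₊₁)`, and for `i = n + 1` it is `(aₙ₊₁ * a₀, a₁, …, aₙ)`. -/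
def faceFun {n : ℕ} (i : Fin (n + 2)) (a : Fin (n + 2) → A) (j : Fin (n + 1)) : A :=
  if i = Fin.last (n + 1) ∧ j = 0 then a (Fin.last (n + 1)) * a 0
  else Fin.contractNth i (· * ·) a j

variable {A}

theorem faceFun_mk {n : ℕ} (i : ℕ) (hi : i < n + 2) (a : Fin (n + 2) → A)
    (j : ℕ) (hj : j < n + 1) :
    faceFun ⟨i, hi⟩ a ⟨j, hj⟩ =
      if i = n + 1 ∧ j = 0 then a ⟨n + 1, by omega⟩ * a ⟨0, by omega⟩
      else if j < i then a ⟨j, by omega⟩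
      else if j = i then a ⟨j, by omega⟩ * a ⟨j + 1, by omega⟩ else a ⟨j + 1, by omega⟩ := by
  simp only [faceFun, Fin.contractNth, Fin.ext_iff, Fin.val_last, Fin.val_zero]
  rfl

theorem faceFun_faceFun {n : ℕ} (i j : ℕ) (hij : i ≤ j) (hj : j ≤ n + 1) (a : Fin (n + 3) → A) :
    faceFun (n := n) ⟨i, by omega⟩ (faceFun (n := n + 1) ⟨j + 1, by omega⟩ a) =
      faceFun (n := n) ⟨j, by omega⟩ (faceFun (n := n + 1) ⟨i, by omega⟩ a) := by
  funext ⟨l, hl⟩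
  simp only [faceFun_mk]
  grind

theorem finRotate_symm_mk {n : ℕ} (j : ℕ) (hj : j < n + 1) :
    (finRotate (n + 1)).symm ⟨j, hj⟩ = ⟨if j = 0 then n else j - 1, by split_ifs <;> omega⟩ := by
  rw [Equiv.symm_apply_eq, Fin.ext_iff, coe_finRotate]
  simp only [Fin.ext_iff, Fin.val_last]
  grind

theorem faceFun_rotate {n : ℕ} (i : ℕ) (hi : i ≤ n) (a : Fin (n + 2) → A) :
    faceFun ⟨i + 1, by omega⟩ (fun j => a ((finRotate (n + 2)).symm j)) =
      fun j => faceFun ⟨i, by omega⟩ a ((finRotate (n + 1)).symm j) := by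
  funext ⟨l, hl⟩
  simp only [faceFun_mk, finRotate_symm_mk]
  grind

theorem faceFun_zero_rotate {n : ℕ} (a : Fin (n + 2) → A) :
    faceFun ⟨0, by omega⟩ (fun j => a ((finRotate (n + 2)).symm j)) =
      faceFun ⟨n + 1, by omega⟩ a := by
  funext ⟨l, hl⟩
  simp only [faceFun_mk, finRotate_symm_mk]
  grind

theorem faceFun_update {n : ℕ} [DecidableEq (Fin (n + 2))] [DecidableEq (Fin (n + 1))]
    (i : Fin (n + 2)) (a : Fin (n + 2) → A) (l : Fin (n + 2)) :
    ∃ (j : Fin (n + 1)) (L : A →ₗ[k] A), ∀ x : A,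
      faceFun i (Function.update a l x) = Function.update (faceFun i a) j (L x) := by
  obtain ⟨i, hi⟩ := i
  obtain ⟨l, hl⟩ := l
  by_cases h1 : l = i
  · refine ⟨⟨if i = n + 1 then 0 else i, by split_ifs <;> omega⟩,
      LinearMap.mulRight k (a ⟨if i = n + 1 then 0 else i + 1, by split_ifs <;> omega⟩),
      fun x => funext fun ⟨j, hj⟩ => ?_⟩
    simp only [faceFun_mk, Function.update_apply, Fin.ext_iff, LinearMap.mulRight_apply]
    grind
  · by_cases h2 : l = i + 1 ∨ (i = n + 1 ∧ l = 0)
    · refine ⟨⟨if i = n + 1 then 0 else i, by split_ifs <;> omega⟩,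
        LinearMap.mulLeft k (a ⟨i, hi⟩), fun x => funext fun ⟨j, hj⟩ => ?_⟩
      simp only [faceFun_mk, Function.update_apply, Fin.ext_iff, LinearMap.mulLeft_apply]
      grind
    · refine ⟨⟨if l < i then l else l - 1, by split_ifs <;> omega⟩, LinearMap.id,
        fun x => funext fun ⟨j, hj⟩ => ?_⟩
      simp only [faceFun_mk, Function.update_apply, Fin.ext_iff, LinearMap.id_apply]
      grind

variable (A)

/-- The face map `dᵢ : A^{⊗ n+2} → A^{⊗ n+1}`, determined by its values on pure tensors. -/
noncomputable def face (n : ℕ) (i : Fin (n + 2)) : Chain k A (n + 1) →ₗ[k] Chain k A n :=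
  PiTensorProduct.lift
    { toFun := fun a => PiTensorProduct.tprod k (faceFun i a)
      map_update_add' := fun a l x y => by
        classical
        obtain ⟨j, L, h⟩ := faceFun_update k i a l
        simp only [h, map_add, MultilinearMap.map_update_add]
      map_update_smul' := fun a l c x => by
        classical
        obtain ⟨j, L, h⟩ := faceFun_update k i a l
        simp only [h, map_smul, MultilinearMap.map_update_smul] }

/-- The Hochschild boundary `b = ∑_{i=0}^{n+1} (-1)^i dᵢ : A^{⊗ n+2} → A^{⊗ n+1}`. -/
noncomputable def b (n : ℕ) : Chain k A (n + 1) →ₗ[k] Chain k A n :=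
  ∑ i : Fin (n + 2), (-1 : k) ^ (i : ℕ) • face k A n i

/-- The bar boundary `b' = ∑_{i=0}^{n} (-1)^i dᵢ : A^{⊗ n+2} → A^{⊗ n+1}`. -/
noncomputable def b' (n : ℕ) : Chain k A (n + 1) →ₗ[k] Chain k A n :=
  ∑ i : Fin (n + 1), (-1 : k) ^ (i : ℕ) • face k A n i.castSucc

/-- The unsigned cyclic rotation `a₀ ⊗ ⋯ ⊗ aₙ ↦ aₙ ⊗ a₀ ⊗ ⋯ ⊗ aₙ₋₁`. -/
noncomputable def rot (n : ℕ) : Module.End k (Chain k A n) :=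
  (PiTensorProduct.reindex k (fun _ : Fin (n + 1) => A) (finRotate (n + 1))).toLinearMap

/-- The signed cyclic operator `t (a₀ ⊗ ⋯ ⊗ aₙ) = (-1)ⁿ aₙ ⊗ a₀ ⊗ ⋯ ⊗ aₙ₋₁`. -/
noncomputable def t (n : ℕ) : Module.End k (Chain k A n) := (-1 : k) ^ n • rot k A n

/-- The norm `N = 1 + t + ⋯ + tⁿ`. -/
noncomputable def N (n : ℕ) : Module.End k (Chain k A n) := ∑ i ∈ Finset.range (n + 1), t k A n ^ i

theorem face_tprod (n : ℕ) (i : Fin (n + 2)) (a : Fin (n + 2) → A) :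
    face k A n i (PiTensorProduct.tprod k a) = PiTensorProduct.tprod k (faceFun i a) := by
  simp [face]

theorem rot_tprod (n : ℕ) (a : Fin (n + 1) → A) :
    rot k A n (PiTensorProduct.tprod k a) =
      PiTensorProduct.tprod k (fun j => a ((finRotate (n + 1)).symm j)) :=
  PiTensorProduct.reindex_tprod _ _

theorem rot_pow_tprod (n r : ℕ) (a : Fin (n + 1) → A) :
    (rot k A n ^ r) (PiTensorProduct.tprod k a) =
      PiTensorProduct.tprod k (fun j => a (((finRotate (n + 1)).symm ^ r) j)) := by
  induction r generalizing a with
  | zero => simp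
  | succ r ih => rw [pow_succ, Module.End.mul_apply, rot_tprod, ih]; simp [pow_succ']

theorem finRotate_symm_pow (n r j : ℕ) (hr : r ≤ n + 1) (hj : j < n + 1) :
    (((finRotate (n + 1)).symm ^ r) ⟨j, hj⟩ : Fin (n + 1)) =
      ⟨if r ≤ j then j - r else j + (n + 1) - r, by split_ifs <;> omega⟩ := by
  induction r with
  | zero => simp
  | succ r ih =>
    rw [pow_succ', Equiv.Perm.mul_apply, ih (by omega), finRotate_symm_mk]
    grind

theorem t_pow_card (n : ℕ) : t k A n ^ (n + 1) = 1 := by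
  have h1 : rot k A n ^ (n + 1) = 1 := by
    apply PiTensorProduct.ext
    ext a
    have : (finRotate (n + 1)).symm ^ (n + 1) = 1 := by
      ext ⟨j, hj⟩
      rw [finRotate_symm_pow n (n + 1) j le_rfl hj, Equiv.Perm.one_apply]
      grind
    rw [LinearMap.compMultilinearMap_apply, rot_pow_tprod, this]
    simp
  rw [t, smul_pow, h1, ← pow_mul, Even.neg_one_pow (Nat.even_mul_succ_self n), one_smul]

theorem one_sub_t_mul_N (n : ℕ) : (1 - t k A n) * N k A n = 0 := by
  rw [N, mul_neg_geom_sum, t_pow_card, sub_self]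

theorem N_mul_one_sub_t (n : ℕ) : N k A n * (1 - t k A n) = 0 := by
  rw [N, geom_sum_mul_neg, t_pow_card, sub_self]

theorem face_comp_face (n i j : ℕ) (hij : i ≤ j) (hj : j ≤ n + 1) :
    face k A n ⟨i, by omega⟩ ∘ₗ face k A (n + 1) ⟨j + 1, by omega⟩ =
      face k A n ⟨j, by omega⟩ ∘ₗ face k A (n + 1) ⟨i, by omega⟩ := by
  apply PiTensorProduct.ext
  ext a
  simp [face_tprod, faceFun_faceFun i j hij hj]

theorem face_succ_comp_t (n i : ℕ) (hi : i ≤ n) :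
    face k A n ⟨i + 1, by omega⟩ ∘ₗ t k A (n + 1) =
      -(t k A n ∘ₗ face k A n ⟨i, by omega⟩) := by
  apply PiTensorProduct.ext
  ext a
  simp [face_tprod, rot_tprod, t, faceFun_rotate i hi, pow_succ]

theorem face_zero_comp_t (n : ℕ) :
    face k A n ⟨0, by omega⟩ ∘ₗ t k A (n + 1) = (-1 : k) ^ (n + 1) • face k A n ⟨n + 1, by omega⟩ := by
  apply PiTensorProduct.ext
  ext a
  simp only [t, LinearMap.compMultilinearMap_apply, LinearMap.comp_apply, LinearMap.smul_apply,
    map_smul, rot_tprod, face_tprod, faceFun_zero_rotate]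

theorem lin_sum_comp {M₁ M₂ M₃ ι : Type*} [AddCommGroup M₁] [AddCommGroup M₂] [AddCommGroup M₃]
    [Module k M₁] [Module k M₂] [Module k M₃] (s : Finset ι) (f : ι → M₂ →ₗ[k] M₃)
    (g : M₁ →ₗ[k] M₂) : (∑ i ∈ s, f i) ∘ₗ g = ∑ i ∈ s, f i ∘ₗ g := by
  ext x
  simp

theorem lin_comp_sum {M₁ M₂ M₃ ι : Type*} [AddCommGroup M₁] [AddCommGroup M₂] [AddCommGroup M₃]
    [Module k M₁] [Module k M₂] [Module k M₃] (s : Finset ι) (f : ι → M₁ →ₗ[k] M₂)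
    (g : M₂ →ₗ[k] M₃) : g ∘ₗ (∑ i ∈ s, f i) = ∑ i ∈ s, g ∘ₗ f i := by
  ext x
  simp

/-- An alternating double sum over faces vanishes by the simplicial identities. -/
theorem alternating_sum_eq_zero {M : Type*} [AddCommGroup M] [Module k M] (m : ℕ)
    (g : ℕ → ℕ → M) (hg : ∀ i j, i ≤ j → j < m → g i (j + 1) = g j i) :
    ∑ i ∈ Finset.range m, ∑ j ∈ Finset.range (m + 1), (-1 : k) ^ (i + j) • g i j = 0 := by
  rw [← Finset.sum_product']
  refine Finset.sum_involution
    (fun x _ => if x.1 < x.2 then (x.2 - 1, x.1) else (x.2, x.1 + 1)) ?_ ?_ ?_ ?_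
  · rintro ⟨i, j⟩ hx
    simp only [Finset.mem_product, Finset.mem_range] at hx
    dsimp only
    split_ifs with h
    · obtain ⟨j, rfl⟩ : ∃ j', j = j' + 1 := ⟨j - 1, by omega⟩
      simp only [Nat.add_sub_cancel]
      rw [hg i j (by omega) (by omega), ← add_smul, show i + (j + 1) = (j + i) + 1 by ring, pow_succ]
      simp
    · simp only
      rw [hg j i (by omega) (by omega), ← add_smul, show j + (i + 1) = (i + j) + 1 by ring, pow_succ]
      simp
  · rintro ⟨i, j⟩ hx _
    grind
  · rintro ⟨i, j⟩ hx
    simp only [Finset.mem_product, Finset.mem_range] at hx ⊢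
    grind
  · rintro ⟨i, j⟩ hx
    grind

/-- The face map indexed by natural numbers, extended by zero. -/
noncomputable def faceNat (n i : ℕ) : Chain k A (n + 1) →ₗ[k] Chain k A n :=
  if h : i < n + 2 then face k A n ⟨i, h⟩ else 0

theorem b_eq (n : ℕ) : b k A n = ∑ i ∈ Finset.range (n + 2), (-1 : k) ^ i • faceNat k A n i := by
  rw [b, Finset.sum_range]
  exact Finset.sum_congr rfl fun i _ => by simp [faceNat]

theorem b'_eq (n : ℕ) : b' k A n = ∑ i ∈ Finset.range (n + 1), (-1 : k) ^ i • faceNat k A n i := by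
  rw [b', Finset.sum_range]
  refine Finset.sum_congr rfl fun i _ => ?_
  rw [faceNat, dif_pos (by omega)]
  rfl

theorem faceNat_comp (n i j : ℕ) (hij : i ≤ j) (hj : j ≤ n + 1) :
    faceNat k A n i ∘ₗ faceNat k A (n + 1) (j + 1) = faceNat k A n j ∘ₗ faceNat k A (n + 1) i := by
  simp only [faceNat]
  rw [dif_pos (by omega), dif_pos (by omega), dif_pos (by omega), dif_pos (by omega)]
  exact face_comp_face k A n i j hij hj

theorem b_comp_b (n : ℕ) : b k A n ∘ₗ b k A (n + 1) = 0 := by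
  rw [b_eq, b_eq, ← alternating_sum_eq_zero k (n + 2)
    (fun i j => faceNat k A n i ∘ₗ faceNat k A (n + 1) j)
    (fun i j h1 h2 => faceNat_comp k A n i j h1 (by omega))]
  simp only [lin_sum_comp]
  simp only [lin_comp_sum, LinearMap.smul_comp, LinearMap.comp_smul, smul_smul, pow_add,
    mul_comm]

theorem b'_comp_b' (n : ℕ) : b' k A n ∘ₗ b' k A (n + 1) = 0 := by
  rw [b'_eq, b'_eq, ← alternating_sum_eq_zero k (n + 1)
    (fun i j => faceNat k A n i ∘ₗ faceNat k A (n + 1) j)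
    (fun i j h1 h2 => faceNat_comp k A n i j h1 (by omega))]
  simp only [lin_sum_comp]
  simp only [lin_comp_sum, LinearMap.smul_comp, LinearMap.comp_smul, smul_smul, pow_add,
    mul_comm]

theorem signed_face_comp_t (n i : ℕ) (hi : i ≤ n) :
    ((-1 : k) ^ (i + 1) • faceNat k A n (i + 1)) ∘ₗ t k A (n + 1) =
      t k A n ∘ₗ ((-1 : k) ^ i • faceNat k A n i) := by
  rw [faceNat, faceNat, dif_pos (by omega), dif_pos (by omega), LinearMap.smul_comp,
    face_succ_comp_t k A n i hi, LinearMap.comp_smul, pow_succ]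
  simp

theorem signed_face_zero_comp_t (n : ℕ) :
    faceNat k A n 0 ∘ₗ t k A (n + 1) = (-1 : k) ^ (n + 1) • faceNat k A n (n + 1) := by
  rw [faceNat, faceNat, dif_pos (by omega), dif_pos (by omega)]
  exact face_zero_comp_t k A n

theorem b_comp_one_sub_t (n : ℕ) :
    b k A n ∘ₗ (1 - t k A (n + 1)) = (1 - t k A n) ∘ₗ b' k A n := by
  have h : b k A n ∘ₗ t k A (n + 1) =
      t k A n ∘ₗ b' k A n + (-1 : k) ^ (n + 1) • faceNat k A n (n + 1) := by
    rw [b_eq, Finset.sum_range_succ', LinearMap.add_comp, lin_sum_comp, b'_eq,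
      lin_comp_sum, pow_zero, one_smul, signed_face_zero_comp_t]
    congr 1
    exact Finset.sum_congr rfl fun i hi =>
      signed_face_comp_t k A n i (by simpa [Nat.lt_succ_iff] using hi)
  have h' : b k A n = b' k A n + (-1 : k) ^ (n + 1) • faceNat k A n (n + 1) := by
    rw [b_eq, b'_eq, Finset.sum_range_succ]
  rw [LinearMap.comp_sub, LinearMap.sub_comp, h, Module.End.one_eq_id, Module.End.one_eq_id,
    LinearMap.comp_id, LinearMap.id_comp, h']
  abel

theorem t_comp_N (n : ℕ) : t k A n ∘ₗ N k A n = N k A n := by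
  have h := one_sub_t_mul_N k A n
  rw [sub_mul, one_mul, sub_eq_zero] at h
  exact h.symm

theorem N_comp_t (n : ℕ) : N k A n ∘ₗ t k A n = N k A n := by
  have h := N_mul_one_sub_t k A n
  rw [mul_sub, mul_one, sub_eq_zero] at h
  exact h.symm

theorem signed_face_comp_N (n i : ℕ) (hi : i ≤ n + 1) :
    ((-1 : k) ^ i • faceNat k A n i) ∘ₗ N k A (n + 1) =
      (t k A n ^ i) ∘ₗ faceNat k A n 0 ∘ₗ N k A (n + 1) := by
  induction i with
  | zero => simp [Module.End.one_eq_id]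
  | succ i ih =>
    rw [← t_comp_N k A (n + 1), ← LinearMap.comp_assoc, signed_face_comp_t k A n i (by omega),
      LinearMap.comp_assoc, ih (by omega), t_comp_N, pow_succ', Module.End.mul_eq_comp,
      LinearMap.comp_assoc]

theorem N_comp_signed_face (n i : ℕ) (hi : i ≤ n + 1) :
    N k A n ∘ₗ ((-1 : k) ^ i • faceNat k A n i) ∘ₗ (t k A (n + 1) ^ i) =
      N k A n ∘ₗ faceNat k A n 0 := by
  induction i with
  | zero => simp [Module.End.one_eq_id]
  | succ i ih =>
    rw [pow_succ' (t k A (n + 1)), Module.End.mul_eq_comp,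
      ← LinearMap.comp_assoc (t k A (n + 1) ^ i), signed_face_comp_t k A n i (by omega),
      LinearMap.comp_assoc, ← LinearMap.comp_assoc, N_comp_t, ih (by omega)]

theorem b'_comp_N (n : ℕ) : b' k A n ∘ₗ N k A (n + 1) = N k A n ∘ₗ b k A n := by
  have h1 : b' k A n ∘ₗ N k A (n + 1) = N k A n ∘ₗ faceNat k A n 0 ∘ₗ N k A (n + 1) := by
    rw [b'_eq, lin_sum_comp,
      show N k A n = ∑ i ∈ Finset.range (n + 1), t k A n ^ i from rfl, lin_sum_comp]
    exact Finset.sum_congr rfl fun i hi =>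
      signed_face_comp_N k A n i (by have := Finset.mem_range.1 hi; omega)
  have h2 : N k A n ∘ₗ b k A n = N k A n ∘ₗ faceNat k A n 0 ∘ₗ N k A (n + 1) := by
    have h3 : ∀ i ∈ Finset.range (n + 2), N k A n ∘ₗ ((-1 : k) ^ i • faceNat k A n i) =
        (N k A n ∘ₗ faceNat k A n 0) ∘ₗ (t k A (n + 1) ^ (n + 2 - i)) := by
      intro i hi
      have hi' := Finset.mem_range.1 hi
      rw [← N_comp_signed_face k A n i (by omega), LinearMap.comp_assoc, LinearMap.comp_assoc,
        ← Module.End.mul_eq_comp (t k A (n + 1) ^ i), ← pow_add,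
        show i + (n + 2 - i) = n + 1 + 1 by omega, t_pow_card, Module.End.one_eq_id,
        LinearMap.comp_id]
    rw [b_eq, lin_comp_sum, Finset.sum_congr rfl h3, ← lin_comp_sum,
      LinearMap.comp_assoc]
    congr 2
    rw [← Finset.sum_range_reflect, N]
    have h4 : ∀ i ∈ Finset.range (n + 2),
        t k A (n + 1) ^ (n + 2 - (n + 2 - 1 - i)) = t k A (n + 1) ^ (i + 1) := by
      intro i hi
      have := Finset.mem_range.1 hi
      congr 1
      omega
    rw [Finset.sum_congr rfl h4, Finset.sum_range_succ, t_pow_card,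
      Finset.sum_range_succ' (fun i => t k A (n + 1) ^ i), pow_zero]
  rw [h1, h2]

/-- The vertical maps of the Tsygan double complex, whose entry in position `(p, q)` is
`A^{⊗ q+1}`: the even columns are Hochschild complexes and the odd ones bar complexes. -/
noncomputable def vert (p q : ℕ) : Chain k A (q + 1) →ₗ[k] Chain k A q :=
  if Even p then b k A q else b' k A q

/-- The horizontal map from position `(p + 1, q)` to position `(p, q)`. -/
noncomputable def horiz (p q : ℕ) : Chain k A q →ₗ[k] Chain k A q :=
  if Even p then 1 - t k A q else N k A q

/-- The degree `n` part of the total complex: the direct sum of the entries in the positions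
`(p, q)` with `p + q = n`. -/
abbrev Tot (n : ℕ) : Type _ := (x : {x : ℕ × ℕ // x.1 + x.2 = n}) → Chain k A x.1.2

/-- The differential of the total complex: `horiz` plus `(-1)^p` times `vert`. -/
noncomputable def totD (n : ℕ) : Tot k A (n + 1) →ₗ[k] Tot k A n :=
  LinearMap.pi fun x =>
    horiz k A x.1.1 x.1.2 ∘ₗ
        LinearMap.proj (⟨(x.1.1 + 1, x.1.2), by have := x.2; dsimp only; omega⟩ :
          {x : ℕ × ℕ // x.1 + x.2 = n + 1}) +
      (-1 : k) ^ x.1.1 • (vert k A x.1.1 x.1.2 ∘ₗ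
        LinearMap.proj (⟨(x.1.1, x.1.2 + 1), by have := x.2; dsimp only; omega⟩ :
          {x : ℕ × ℕ // x.1 + x.2 = n + 1}))

theorem vert_comp_vert (p q : ℕ) : vert k A p q ∘ₗ vert k A p (q + 1) = 0 := by
  unfold vert
  split_ifs
  · exact b_comp_b k A q
  · exact b'_comp_b' k A q

theorem horiz_comp_horiz (p q : ℕ) : horiz k A p q ∘ₗ horiz k A (p + 1) q = 0 := by
  unfold horiz
  by_cases h : Even p
  · rw [if_pos h, if_neg (by simpa [Nat.even_add_one] using h)]
    exact one_sub_t_mul_N k A q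
  · rw [if_neg h, if_pos (by simpa [Nat.even_add_one] using h)]
    exact N_mul_one_sub_t k A q

theorem vert_comp_horiz (p q : ℕ) :
    vert k A p q ∘ₗ horiz k A p (q + 1) = horiz k A p q ∘ₗ vert k A (p + 1) q := by
  unfold horiz vert
  by_cases h : Even p
  · rw [if_pos h, if_pos h, if_pos h, if_neg (by simpa [Nat.even_add_one] using h)]
    exact b_comp_one_sub_t k A q
  · rw [if_neg h, if_neg h, if_neg h, if_pos (by simpa [Nat.even_add_one] using h)]
    exact b'_comp_N k A q

theorem totD_comp_totD (n : ℕ) : totD k A n ∘ₗ totD k A (n + 1) = 0 := by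
  refine LinearMap.ext fun f => funext fun ⟨⟨p, q⟩, hx⟩ => ?_
  have h1 := fun y => LinearMap.congr_fun (horiz_comp_horiz k A p q) y
  have h2 := fun y => LinearMap.congr_fun (vert_comp_vert k A p q) y
  have h3 := fun y => LinearMap.congr_fun (vert_comp_horiz k A p q) y
  simp only [LinearMap.comp_apply, LinearMap.zero_apply] at h1 h2 h3
  simp only [totD, LinearMap.comp_apply, LinearMap.pi_apply, LinearMap.add_apply,
    LinearMap.smul_apply, LinearMap.proj_apply, map_add, map_smul, h1, h2, h3, LinearMap.zero_apply,
    Pi.zero_apply, pow_succ]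
  simp

end General

section Weight

open MvPolynomial

variable (k : Type u) [CommRing k] (d : ℕ)

/-- The ring `k[x₁, …, x_d] / 𝔪²`, where `𝔪 = (x₁, …, x_d)`. -/
abbrev TruncPoly : Type u :=
  MvPolynomial (Fin d) k ⧸
    (Ideal.span (Set.range (X : Fin d → MvPolynomial (Fin d) k)) ^ 2)

/-- The `k`-basis `1, x₁, …, x_d` of `k[x₁, …, x_d] / 𝔪²`; here `none` stands for `1`. -/
noncomputable def mono : Option (Fin d) → TruncPoly k d
  | none => 1
  | some i => Ideal.Quotient.mk _ (X i)

/-- The weight `w` part of `A^{⊗ n+1}` for `A = k[x₁, …, x_d] / 𝔪²`: the span of those tensor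
monomials in `1, x₁, …, x_d` in which exactly `w` of the tensor factors are among the `xᵢ`. -/
noncomputable def weightPart (w n : ℕ) : Submodule k (Chain k (TruncPoly k d) n) :=
  Submodule.span k {y | ∃ v : Fin (n + 1) → Option (Fin d),
    (Finset.univ.filter fun j => (v j).isSome).card = w ∧
      y = PiTensorProduct.tprod k fun j => mono k d (v j)}

theorem mono_mul_mono (i j : Fin d) : mono k d (some i) * mono k d (some j) = 0 := by
  simp only [mono, ← map_mul]
  rw [Ideal.Quotient.eq_zero_iff_mem, pow_two]
  exact Ideal.mul_mem_mul (Ideal.subset_span ⟨i, rfl⟩) (Ideal.subset_span ⟨j, rfl⟩)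

theorem t_mem (w n : ℕ) {y : Chain k (TruncPoly k d) n} (hy : y ∈ weightPart k d w n) :
    t k (TruncPoly k d) n y ∈ weightPart k d w n := by
  refine (Submodule.span_le.2 ?_ :
    weightPart k d w n ≤ (weightPart k d w n).comap (t k (TruncPoly k d) n)) hy
  rintro _ ⟨v, hv, rfl⟩
  rw [SetLike.mem_coe, Submodule.mem_comap, t, LinearMap.smul_apply, rot_tprod]
  refine Submodule.smul_mem _ _ (Submodule.subset_span
    ⟨fun j => v ((finRotate (n + 1)).symm j), ?_, rfl⟩)
  rw [← hv, Finset.card_filter, Finset.card_filter]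
  exact Equiv.sum_comp (finRotate (n + 1)).symm fun j => if (v j).isSome then 1 else 0

theorem t_pow_mem (w n r : ℕ) {y : Chain k (TruncPoly k d) n} (hy : y ∈ weightPart k d w n) :
    (t k (TruncPoly k d) n ^ r) y ∈ weightPart k d w n := by
  rw [Module.End.pow_apply]
  induction r with
  | zero => exact hy
  | succ r ih =>
    rw [Function.iterate_succ_apply']
    exact t_mem k d w n ih

theorem N_mem (w n : ℕ) {y : Chain k (TruncPoly k d) n} (hy : y ∈ weightPart k d w n) :
    N k (TruncPoly k d) n y ∈ weightPart k d w n := by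
  rw [N, LinearMap.sum_apply]
  exact Submodule.sum_mem _ fun i _ => t_pow_mem k d w n i hy

theorem face_zero_mem (w n : ℕ) {y : Chain k (TruncPoly k d) (n + 1)}
    (hy : y ∈ weightPart k d w (n + 1)) :
    face k (TruncPoly k d) n ⟨0, by omega⟩ y ∈ weightPart k d w n := by
  refine (Submodule.span_le.2 ?_ : weightPart k d w (n + 1) ≤
    (weightPart k d w n).comap (face k (TruncPoly k d) n ⟨0, by omega⟩)) hy
  rintro _ ⟨v, hv, rfl⟩
  rw [SetLike.mem_coe, Submodule.mem_comap, face_tprod]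
  have h0 : faceFun ⟨0, by omega⟩ (fun j => mono k d (v j)) (0 : Fin (n + 1)) =
      mono k d (v 0) * mono k d (v 1) := by
    rw [show (0 : Fin (n + 1)) = ⟨0, by omega⟩ from rfl, faceFun_mk]
    simp
  have hs : ∀ j : Fin n, faceFun ⟨0, by omega⟩ (fun j => mono k d (v j)) j.succ =
      mono k d (v j.succ.succ) := by
    intro ⟨j, hj⟩
    rw [Fin.succ_mk, faceFun_mk]
    simp
  rw [Finset.card_filter, Fin.sum_univ_succ, Fin.sum_univ_succ, Fin.succ_zero_eq_one] at hv
  by_cases h : (v 0).isSome ∧ (v 1).isSome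
  · obtain ⟨i, hi⟩ := Option.isSome_iff_exists.1 h.1
    obtain ⟨j, hj⟩ := Option.isSome_iff_exists.1 h.2
    rw [MultilinearMap.map_coord_zero _ (0 : Fin (n + 1)) (by rw [h0, hi, hj, mono_mul_mono])]
    exact Submodule.zero_mem _
  · refine Submodule.subset_span ⟨Fin.cons ((v 0).or (v 1)) fun j => v j.succ.succ, ?_, ?_⟩
    · rw [← hv, Finset.card_filter, Fin.sum_univ_succ, Fin.cons_zero, ← add_assoc]
      simp only [Fin.cons_succ]
      congr 1
      cases h1 : v 0 <;> cases h2 : v 1 <;> simp_all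
    · congr 1
      funext j
      refine Fin.cases ?_ (fun j => ?_) j
      · rw [h0, Fin.cons_zero]
        cases h1 : v 0 <;> cases h2 : v 1 <;> simp_all [mono]
      · rw [hs, Fin.cons_succ]

theorem face_mem (w n i : ℕ) (hi : i < n + 2) {y : Chain k (TruncPoly k d) (n + 1)}
    (hy : y ∈ weightPart k d w (n + 1)) :
    face k (TruncPoly k d) n ⟨i, hi⟩ y ∈ weightPart k d w n := by
  induction i generalizing y with
  | zero => exact face_zero_mem k d w n hy
  | succ i ih =>
    have h1 : y = t k (TruncPoly k d) (n + 1) ((t k (TruncPoly k d) (n + 1) ^ (n + 1)) y) := by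
      rw [← Module.End.mul_apply, ← pow_succ', t_pow_card, Module.End.one_apply]
    rw [h1, ← LinearMap.comp_apply, face_succ_comp_t k _ n i (by omega), LinearMap.neg_apply]
    exact Submodule.neg_mem _ (t_mem k d w n (ih (by omega) (t_pow_mem k d w (n + 1) (n + 1) hy)))

theorem vert_mem (w p q : ℕ) {y : Chain k (TruncPoly k d) (q + 1)}
    (hy : y ∈ weightPart k d w (q + 1)) :
    vert k (TruncPoly k d) p q y ∈ weightPart k d w q := by
  unfold vert
  split_ifs
  · rw [b, LinearMap.sum_apply]
    exact Submodule.sum_mem _ fun i _ => Submodule.smul_mem _ _ (face_mem k d w q i i.2 hy)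
  · rw [b', LinearMap.sum_apply]
    exact Submodule.sum_mem _ fun i _ =>
      Submodule.smul_mem _ _ (face_mem k d w q i i.castSucc.2 hy)

theorem horiz_mem (w p q : ℕ) {y : Chain k (TruncPoly k d) q} (hy : y ∈ weightPart k d w q) :
    horiz k (TruncPoly k d) p q y ∈ weightPart k d w q := by
  unfold horiz
  split_ifs
  · exact Submodule.sub_mem _ hy (t_mem k d w q hy)
  · exact N_mem k d w q hy

/-- The weight `w` part of the total Tsygan complex in degree `n`: every component has weight
`w`. -/
noncomputable def totWeight (w n : ℕ) : Submodule k (Tot k (TruncPoly k d) n) :=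
  Submodule.pi Set.univ fun x => weightPart k d w x.1.2

theorem totD_mem (w n : ℕ) (f : Tot k (TruncPoly k d) (n + 1))
    (hf : f ∈ totWeight k d w (n + 1)) : totD k (TruncPoly k d) n f ∈ totWeight k d w n := by
  intro x _
  exact Submodule.add_mem _
    (horiz_mem k d w _ _ (hf (⟨(x.1.1 + 1, x.1.2), _⟩ : {x : ℕ × ℕ // _}) trivial))
    (Submodule.smul_mem _ _
      (vert_mem k d w _ _ (hf (⟨(x.1.1, x.1.2 + 1), _⟩ : {x : ℕ × ℕ // _}) trivial)))

/-- The weight `w` subcomplex of the total complex of the Tsygan double complex of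
`k[x₁, …, x_d] / 𝔪²`. -/
noncomputable def weightComplex (w : ℕ) : ChainComplex (ModuleCat.{u} k) ℕ :=
  ChainComplex.of (fun n => ModuleCat.of k (totWeight k d w n))
    (fun n => ModuleCat.ofHom ((totD k (TruncPoly k d) n).restrict (totD_mem k d w n)))
    (fun n => by
      refine ModuleCat.hom_ext (LinearMap.ext fun f => Subtype.ext ?_)
      exact LinearMap.congr_fun (totD_comp_totD k (TruncPoly k d) n) f.1)

/-- The weight `w` part `HC_n^{(w)}` of the cyclic homology of `k[x₁, …, x_d] / 𝔪²` over `k`. -/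
noncomputable abbrev HC (w n : ℕ) : ModuleCat.{u} k := (weightComplex k d w).homology n

end Weight

/-- Rotation of words of length `m` in the letters `x₁, …, x_d`: the last letter is moved to the
front. -/
def rotWord (m d : ℕ) (v : Fin m → Fin d) : Fin m → Fin d := fun j => v ((finRotate m).symm j)

/-- The cycle family of a word: the set of all its rotations. -/
def cycleFamily {m d : ℕ} (v : Fin m → Fin d) : Set (Fin m → Fin d) :=
  {u | ∃ r : ℕ, u = (rotWord m d)^[r] v}

/-- The cycle length of a word: the least `r > 0` such that `r` rotations fix the word. -/
noncomputable def cycleLength {m d : ℕ} (v : Fin m → Fin d) : ℕ :=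
  sInf {r | 0 < r ∧ (rotWord m d)^[r] v = v}

/-- The set `ω_{m,d}` of cycle families of words of length `m` and cycle length `m` in
`x₁, …, x_d`. -/
def omega (m d : ℕ) : Set (Set (Fin m → Fin d)) :=
  {S | ∃ v : Fin m → Fin d, cycleLength v = m ∧ S = cycleFamily v}

end Tsygan

/-! Over `ℚ` the rows of the double complex are exact away from column 0, so HC is the homology of
the coinvariants `A^{⊗ n+1} / (1 - t)` with boundary induced by `b`
(`nonempty_HC_equiv_of_coinvariants`). Everything is then computed there, weight by weight, in the
basis of tensor monomials, read as words in the letters `xᵢ` and the symbol 1.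

Weight 0 is spanned by `1 ⊗ ⋯ ⊗ 1`, on which `t` acts by `(-1)^n`. Hence the coinvariants are `ℚ` in
even degrees and 0 in odd degrees, and no differential can survive.

In positive weight every word can be rotated to begin with a letter. Products of two letters vanish,
and on such words `b` becomes, up to sign, the merging of adjacent ones (`toWords_b`). Inserting a
one into each run of ones is a homotopy between zero and the operator counting runs
(`merge_grow_add_grow_merge`). It is compatible with coinvariants because, modulo rotation, it
equals the insertion into the first run applied to the norm (`growFirst_turn_sum_mem`); it therefore
sends every chain killed by `N` into the image of `1 - t`. As soon as a one is present, the run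
count of a word beginning with a letter is positive, so the coinvariant complex is acyclic in
degrees `n ≥ w` (`exists_b_add_of_N_b_eq_zero`). For `n < w - 1` there are no words at all.

What remains is `n = w - 1`, where words consist of letters only. The incoming boundary vanishes,
since a single one cannot be merged, and the outgoing one has no target. So HC is the space of
coinvariants of words under the signed rotation. An orbit of cycle length `m` contributes `ℚ` if the
sign `(-1)^{nm}` of its stabilizer is trivial, and 0 otherwise; for `m ∣ n + 1` the sign is trivial
exactly when `m ≡ w` mod 2. A word of cycle length `m` is the repetition of a word of length `m`
with full cycle length, which identifies the orbits with elements of `ω_{m,d}`.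

The same decomposition of all words of length `w` gives `∑_{m ∣ w} m |ω_{m,d}| = d^w`, and Möbius
inversion gives the count. -/

namespace Tsygan

/-! ### Words in ones and letters, and the merge/grow homotopy. -/

section ListAlgebra

variable {β : Type*}

/-- The rational vector space on the words in `1` (encoded as `none`) and the letters `some x`. -/
abbrev Words (β : Type*) := List (Option β) →₀ ℚ

/-- Prepending a letter to a word. -/
noncomputable def consMap (a : Option β) : Words β →ₗ[ℚ] Words β :=
  Finsupp.lmapDomain ℚ ℚ (List.cons a)

@[simp] theorem consMap_single (a : Option β) (l : List (Option β)) (c : ℚ) :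
    consMap a (Finsupp.single l c) = Finsupp.single (a :: l) c := by
  simp [consMap]

/-- The signed sum of all contractions of two adjacent ones of a word. -/
noncomputable def mergeWord : List (Option β) → Words β
  | [] => 0
  | [_] => 0
  | none :: none :: l => Finsupp.single (none :: l) 1 - consMap none (mergeWord (none :: l))
  | none :: some x :: l => - consMap none (mergeWord (some x :: l))
  | some x :: c :: l => - consMap (some x) (mergeWord (c :: l))

/-- Doubling the second letter of a word if it begins with a letter and a one. -/
noncomputable def growHead : List (Option β) → Words β
  | some x :: none :: l => Finsupp.single (some x :: none :: none :: l) 1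
  | _ => 0

/-- The signed sum of all insertions of a one into a nonempty run of ones preceded by a letter. -/
noncomputable def growWord : List (Option β) → Words β
  | [] => 0
  | a :: l => growHead (a :: l) - consMap a (growWord l)

/-- The number of places where a one follows a letter. -/
def runCount : List (Option β) → ℕ
  | some _ :: none :: l => runCount (none :: l) + 1
  | _ :: l => runCount l
  | [] => 0

/-- The linear extension of `mergeWord`. -/
noncomputable def merge : Words β →ₗ[ℚ] Words β := Finsupp.linearCombination ℚ mergeWord

/-- The linear extension of `growWord`. -/
noncomputable def grow : Words β →ₗ[ℚ] Words β := Finsupp.linearCombination ℚ growWord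

/-- The linear extension of `growHead`. -/
noncomputable def growFirst : Words β →ₗ[ℚ] Words β := Finsupp.linearCombination ℚ growHead

/-- The diagonal operator counting the runs of ones that follow a letter. -/
noncomputable def runs : Words β →ₗ[ℚ] Words β :=
  Finsupp.linearCombination ℚ fun l => Finsupp.single l (runCount l : ℚ)

/-- A word if it begins with a one, and zero otherwise. -/
noncomputable def oneFirstWord : List (Option β) → Words β
  | [] => 0
  | none :: l => Finsupp.single (none :: l) 1
  | some _ :: _ => 0

/-- The projection onto the words that begin with a one. -/
noncomputable def oneFirst : Words β →ₗ[ℚ] Words β := Finsupp.linearCombination ℚ oneFirstWord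

@[simp] theorem merge_single (l : List (Option β)) : merge (Finsupp.single l 1) = mergeWord l := by
  simp [merge]
@[simp] theorem grow_single (l : List (Option β)) : grow (Finsupp.single l 1) = growWord l := by
  simp [grow]
@[simp] theorem growFirst_single (l : List (Option β)) :
    growFirst (Finsupp.single l 1) = growHead l := by
  simp [growFirst]
@[simp] theorem runs_single (l : List (Option β)) :
    runs (Finsupp.single l 1) = Finsupp.single l (runCount l : ℚ) := by
  simp [runs]
@[simp] theorem oneFirst_single (l : List (Option β)) :
    oneFirst (Finsupp.single l 1) = oneFirstWord l := by
  simp [oneFirst]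

theorem words_ext {M : Type*} [AddCommGroup M] [Module ℚ M] {f g : Words β →ₗ[ℚ] M}
    (h : ∀ l, f (Finsupp.single l 1) = g (Finsupp.single l 1)) : f = g :=
  Finsupp.lhom_ext' fun l => LinearMap.ext_ring (h l)

/-- Recursion rules like this one and its companions reduce the homotopy identity to formal algebra
with `consMap` and `oneFirst`, without tracking positions in a word. -/
theorem merge_cons_none (r : Words β) :
    merge (consMap none r) = oneFirst r - consMap none (merge r) := by
  suffices h : merge ∘ₗ consMap none = oneFirst - consMap (β := β) none ∘ₗ merge from
    LinearMap.congr_fun h r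
  refine words_ext fun l => ?_
  match l with
  | [] => simp [mergeWord, oneFirstWord]
  | none :: l => simp [mergeWord, oneFirstWord]
  | some x :: l => simp [mergeWord, oneFirstWord]

theorem merge_cons_some (x : β) (r : Words β) :
    merge (consMap (some x) r) = - consMap (some x) (merge r) := by
  suffices h : merge ∘ₗ consMap (some x) = - consMap (β := β) (some x) ∘ₗ merge from
    LinearMap.congr_fun h r
  refine words_ext fun l => ?_
  match l with
  | [] => simp [mergeWord]
  | c :: l => simp [mergeWord]

theorem grow_cons_none (r : Words β) :
    grow (consMap none r) = - consMap none (grow r) := by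
  suffices h : grow ∘ₗ consMap none = - consMap (β := β) none ∘ₗ grow from
    LinearMap.congr_fun h r
  exact words_ext fun l => by simp [growWord, growHead]

theorem grow_cons_some (x : β) (r : Words β) :
    grow (consMap (some x) r) =
      consMap (some x) (consMap none (oneFirst r)) - consMap (some x) (grow r) := by
  suffices h : grow ∘ₗ consMap (some x) = consMap (some x) ∘ₗ consMap none ∘ₗ oneFirst
      - consMap (β := β) (some x) ∘ₗ grow from LinearMap.congr_fun h r
  refine words_ext fun l => ?_
  match l with
  | [] => simp [growWord, growHead, oneFirstWord]
  | none :: l => simp [growWord, growHead, oneFirstWord]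
  | some y :: l => simp [growWord, growHead, oneFirstWord]

theorem oneFirst_cons_none (r : Words β) : oneFirst (consMap none r) = consMap none r := by
  suffices h : oneFirst ∘ₗ consMap none = consMap (β := β) none from LinearMap.congr_fun h r
  exact words_ext fun l => by simp [oneFirstWord]

theorem oneFirst_cons_some (x : β) (r : Words β) : oneFirst (consMap (some x) r) = 0 := by
  suffices h : oneFirst ∘ₗ consMap (some x) = (0 : Words β →ₗ[ℚ] Words β) from
    LinearMap.congr_fun h r
  exact words_ext fun l => by simp [oneFirstWord]

theorem oneFirst_oneFirst (r : Words β) : oneFirst (oneFirst r) = oneFirst r := by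
  suffices h : oneFirst ∘ₗ oneFirst = (oneFirst : Words β →ₗ[ℚ] Words β) from
    LinearMap.congr_fun h r
  refine words_ext fun l => ?_
  match l with
  | [] => simp [oneFirstWord]
  | none :: l => simp [oneFirstWord]
  | some x :: l => simp [oneFirstWord]

theorem oneFirst_merge (r : Words β) : oneFirst (merge r) = merge (oneFirst r) := by
  suffices h : oneFirst ∘ₗ merge = merge ∘ₗ (oneFirst : Words β →ₗ[ℚ] Words β) from
    LinearMap.congr_fun h r
  refine words_ext fun l => ?_
  match l with
  | [] => simp [mergeWord, oneFirstWord]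
  | none :: l =>
    have h := merge_cons_none (Finsupp.single l 1)
    rw [consMap_single] at h
    simp only [LinearMap.comp_apply]
    rw [oneFirst_single, oneFirstWord, h, map_sub, oneFirst_oneFirst, oneFirst_cons_none]
  | some x :: l =>
    have h := merge_cons_some x (Finsupp.single l 1)
    rw [consMap_single] at h
    simp only [LinearMap.comp_apply]
    rw [oneFirst_single, oneFirstWord, h, map_neg, oneFirst_cons_some, neg_zero, map_zero]

theorem oneFirst_grow (r : Words β) : oneFirst (grow r) = grow (oneFirst r) := by
  suffices h : oneFirst ∘ₗ grow = grow ∘ₗ (oneFirst : Words β →ₗ[ℚ] Words β) from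
    LinearMap.congr_fun h r
  refine words_ext fun l => ?_
  match l with
  | [] => simp [growWord, oneFirstWord]
  | none :: l =>
    have h := grow_cons_none (Finsupp.single l 1)
    rw [consMap_single] at h
    simp only [LinearMap.comp_apply]
    rw [oneFirst_single, oneFirstWord, h, map_neg, oneFirst_cons_none]
  | some x :: l =>
    have h := grow_cons_some x (Finsupp.single l 1)
    rw [consMap_single] at h
    simp only [LinearMap.comp_apply]
    rw [oneFirst_single, oneFirstWord, h, map_sub, oneFirst_cons_some, oneFirst_cons_some,
      sub_zero, map_zero]

/-- Inserting ones is a contracting homotopy for merging ones, up to the number of runs. -/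
theorem merge_grow_add_grow_merge (r : Words β) : merge (grow r) + grow (merge r) = - runs r := by
  suffices h : merge ∘ₗ grow + grow ∘ₗ merge = - (runs : Words β →ₗ[ℚ] Words β) from
    LinearMap.congr_fun h r
  refine words_ext fun l => ?_
  simp only [LinearMap.add_apply, LinearMap.comp_apply, LinearMap.neg_apply]
  induction l with
  | nil => simp [mergeWord, growWord, runCount]
  | cons a l ih =>
    have hc : Finsupp.single (a :: l) (1 : ℚ) = consMap a (Finsupp.single l 1) := by simp
    rw [eq_neg_iff_add_eq_zero] at ih
    match a with
    | none =>
      have hr : runs (consMap none (Finsupp.single l (1 : ℚ))) =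
          consMap (β := β) none (runs (Finsupp.single l 1)) := by
        simp [runCount]
      rw [hc, hr, grow_cons_none, merge_cons_none, map_neg, merge_cons_none, map_sub,
        grow_cons_none, oneFirst_grow, eq_neg_iff_add_eq_zero]
      have h1 := congrArg (consMap none) ih
      simp only [map_add, map_zero] at h1
      rw [← h1]
      abel
    | some x =>
      have hr : runs (consMap (some x) (Finsupp.single l (1 : ℚ))) =
          consMap (some x) (runs (Finsupp.single l 1)) +
            consMap (some x) (oneFirst (Finsupp.single l 1)) := by
        match l with
        | [] => simp [runCount, oneFirstWord]
        | none :: l => simp [runCount, oneFirstWord]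
        | some y :: l => simp [runCount, oneFirstWord]
      rw [hc, hr, grow_cons_some, merge_cons_some, map_neg, map_sub, merge_cons_some,
        merge_cons_some, merge_cons_none, grow_cons_some, oneFirst_oneFirst, oneFirst_merge,
        -- The `oneFirst` terms involving `merge r` cancel because `oneFirst` commutes with `merge`;
        -- the one that is left over counts the new run after `x`.
        eq_neg_iff_add_eq_zero]
      have h1 := congrArg (consMap (some x)) ih
      simp only [map_add, map_zero] at h1
      rw [← h1]
      simp only [map_sub]
      abel

end ListAlgebra

/-! ### Signed rotation of words, and the homotopy modulo rotation. -/

section Rotation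

variable {β : Type*}

/-- The signed rotation of words that moves the first letter to the end. -/
noncomputable def turn : Words β →ₗ[ℚ] Words β :=
  Finsupp.linearCombination ℚ fun l => (-1 : ℚ) ^ (l.length + 1) • Finsupp.single (l.rotate 1) 1

@[simp] theorem turn_single (l : List (Option β)) :
    turn (Finsupp.single l 1) = (-1 : ℚ) ^ (l.length + 1) • Finsupp.single (l.rotate 1) 1 := by
  simp [turn]

/-- The words of length `m` with exactly `w` letters other than `1`. -/
def wordSet (β : Type*) (w m : ℕ) : Set (List (Option β)) :=
  {l | l.length = m ∧ l.countP Option.isSome = w}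

/-- The span of the words of length `m` and weight `w`. -/
noncomputable def wordSpan (β : Type*) (w m : ℕ) : Submodule ℚ (Words β) :=
  Finsupp.supported ℚ ℚ (wordSet β w m)

/-- The combinations of words that vanish in the coinvariants of the signed rotation. -/
noncomputable def turnSpan (β : Type*) (w m : ℕ) : Submodule ℚ (Words β) :=
  (wordSpan β w m).map (1 - turn)

theorem single_mem_wordSpan {w m : ℕ} {l : List (Option β)} (h : l ∈ wordSet β w m) (c : ℚ) :
    Finsupp.single l c ∈ wordSpan β w m :=
  Finsupp.single_mem_supported ℚ c h

/-- The letters of `p` are turned to the end one at a time; each of them passes `|p| + |s| - 1`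
others, which gives the total sign `(-1)^{|p||s|}` after even contributions are discarded. -/
theorem single_sub_swap_mem (w m : ℕ) (p s : List (Option β)) (h : p ++ s ∈ wordSet β w m) :
    Finsupp.single (p ++ s) (1 : ℚ) -
      (-1 : ℚ) ^ (p.length * s.length) • Finsupp.single (s ++ p) 1 ∈ turnSpan β w m := by
  induction p generalizing s with
  | nil => simp
  | cons a p ih =>
    have h1 : p ++ (s ++ [a]) ∈ wordSet β w m := by
      simp only [wordSet, Set.mem_ofPred_eq, List.length_append, List.countP_append,
        List.length_cons, List.countP_cons] at h ⊢
      simp only [List.countP_nil, List.length_nil]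
      omega
    have h2 : (1 - turn) (Finsupp.single (a :: p ++ s) 1) ∈ turnSpan β w m :=
      Submodule.mem_map_of_mem (single_mem_wordSpan h 1)
    have h3 := Submodule.smul_mem _ ((-1 : ℚ) ^ (p.length + s.length)) (ih (s ++ [a]) h1)
    convert add_mem h2 h3 using 1
    have hs : (-1 : ℚ) ^ (p.length + s.length) * (-1 : ℚ) ^ (p.length * (s.length + 1)) =
        (-1 : ℚ) ^ ((p.length + 1) * s.length) := by
      rw [← pow_add, show p.length + s.length + p.length * (s.length + 1) =
        (p.length + 1) * s.length + 2 * p.length by ring, pow_add, pow_mul _ 2]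
      simp
    simp only [LinearMap.sub_apply, Module.End.one_apply, turn_single, List.cons_append,
      List.length_cons, List.length_append, List.rotate_cons_succ, List.rotate_zero,
      List.append_assoc, smul_sub, smul_smul, List.length_nil, zero_add]
    rw [← hs]
    simp only [List.nil_append]
    rw [show (-1 : ℚ) ^ (p.length + s.length + 1 + 1) = (-1 : ℚ) ^ (p.length + s.length) by
      rw [pow_succ, pow_succ]; ring]
    abel

theorem turn_pow_single (l : List (Option β)) (k : ℕ) :
    (turn ^ k) (Finsupp.single l 1) =
      (-1 : ℚ) ^ ((l.length + 1) * k) • Finsupp.single (l.rotate k) 1 := by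
  induction k with
  | zero => simp
  | succ k ih =>
    rw [pow_succ', Module.End.mul_apply, ih, map_smul, turn_single, smul_smul, List.length_rotate,
      List.rotate_rotate, ← pow_add]
    rfl

/-- Prepending a word. -/
noncomputable def prepend (p : List (Option β)) : Words β →ₗ[ℚ] Words β :=
  Finsupp.lmapDomain ℚ ℚ (p ++ ·)

@[simp] theorem prepend_single (p l : List (Option β)) (c : ℚ) :
    prepend p (Finsupp.single l c) = Finsupp.single (p ++ l) c := by
  simp [prepend]

theorem prepend_consMap (p : List (Option β)) (a : Option β) (r : Words β) :
    prepend p (consMap a r) = prepend (p ++ [a]) r := by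
  suffices h : prepend p ∘ₗ consMap a = prepend (p ++ [a]) from LinearMap.congr_fun h r
  exact words_ext fun l => by simp

/-- Growing the run after the first letter of `q` can be done in place or after rotating `q` to the
front. The grown word has one more entry, so the two swap signs differ by `(-1)^{|p|}`. -/
theorem growHead_swap_mem (w m : ℕ) (p q : List (Option β)) (x : β) (l : List (Option β))
    (hpq : p ++ q = some x :: l) (hq : q ≠ []) (h : p ++ q ∈ wordSet β w m) :
    (-1 : ℚ) ^ (p.length * q.length) • growHead (q ++ p) -
      (-1 : ℚ) ^ p.length • prepend p (growHead q) ∈ turnSpan β w (m + 1) := by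
  match q with
  | [] => exact absurd rfl hq
  | none :: q => simp [growHead]
  | some y :: some z :: q => simp [growHead]
  -- Here rotation could create a run after `y` out of ones at the start of `p`. This is where it is
  -- needed that the whole word begins with a letter: no run wraps around the end.
  | [some y] =>
    match p with
    | [] => simp [growHead]
    | none :: p => simp at hpq
    | some z :: p => simp [growHead]
  | some y :: none :: q =>
    have h1 : p ++ (some y :: none :: none :: q) ∈ wordSet β w (m + 1) := by
      simp only [wordSet, Set.mem_ofPred_eq, List.length_append, List.countP_append,
        List.length_cons, List.countP_cons] at h ⊢
      simp only [Option.isSome_some, Option.isSome_none, if_true, Bool.false_eq_true, if_false] at h ⊢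
      omega
    have h2 := Submodule.smul_mem _ (-(-1 : ℚ) ^ p.length) (single_sub_swap_mem w (m + 1) _ _ h1)
    convert h2 using 1
    simp only [growHead, List.cons_append, prepend_single, smul_sub, neg_smul, smul_smul,
      List.length_cons]
    rw [neg_mul, ← pow_add, show p.length + p.length * (q.length + 1 + 1 + 1) =
        p.length * (q.length + 1 + 1) + 2 * p.length by ring, pow_add, pow_mul _ 2]
    simp only [even_two, Even.neg_pow, one_pow, mul_one, neg_smul]
    abel

/-- The induction moves the cut between `p` and `q` to the right; each step matches one rotation of
the word with one summand of `growWord`. -/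
theorem growHead_rotate_sum_mem (w m : ℕ) (p q : List (Option β)) (x : β) (l : List (Option β))
    (hpq : p ++ q = some x :: l) (h : p ++ q ∈ wordSet β w m) :
    ∑ k ∈ Finset.range q.length, (-1 : ℚ) ^ ((p.length + k) * (m - (p.length + k))) •
        growHead ((p ++ q).rotate (p.length + k)) -
      (-1 : ℚ) ^ p.length • prepend p (growWord q) ∈ turnSpan β w (m + 1) := by
  induction q generalizing p with
  | nil => simp [growWord]
  | cons a q ih =>
    have e : p ++ a :: q = (p ++ [a]) ++ q := by simp
    have h1 := ih (p ++ [a]) (e ▸ hpq) (e ▸ h)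
    have h2 := growHead_swap_mem w m p (a :: q) x l hpq (by simp) h
    convert add_mem h1 h2 using 1
    have hm : m = p.length + (q.length + 1) := by rw [← h.1]; simp
    rw [List.length_cons, Finset.sum_range_succ', growWord, map_sub, prepend_consMap, add_zero,
      List.rotate_append_length_eq, e, smul_sub, hm]
    simp only [List.length_append, List.length_cons, List.length_nil, add_assoc, zero_add,
      add_comm 1, pow_succ, add_tsub_cancel_left]
    simp only [mul_neg, mul_one, neg_smul]
    abel

/-- On words beginning with a letter, growing all runs of ones agrees, up to rotation, with growing
the first run of all rotated words. -/
theorem growFirst_turn_sum_mem (w m : ℕ) (x : β) (l : List (Option β))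
    (h : some x :: l ∈ wordSet β w m) :
    growFirst (∑ k ∈ Finset.range m, (turn ^ k) (Finsupp.single (some x :: l) 1)) -
      growWord (some x :: l) ∈ turnSpan β w (m + 1) := by
  have h1 := growHead_rotate_sum_mem w m [] (some x :: l) x l rfl h
  convert h1 using 2
  · rw [map_sum, h.1]
    refine Finset.sum_congr rfl fun k hk => ?_
    rw [turn_pow_single, map_smul, growFirst_single, h.1]
    simp only [List.nil_append, List.length_nil, zero_add]
    congr 1
    -- The signs `(-1)^{(m+1)k}` and `(-1)^{k(m-k)}` agree, since the exponents differ by the even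
    -- number `k(k+1)`.
    obtain ⟨j, rfl⟩ : ∃ j, m = k + j := ⟨m - k, by have := Finset.mem_range.1 hk; omega⟩
    rw [add_tsub_cancel_left, show (k + j + 1) * k = k * j + k * (k + 1) by ring, pow_add,
      (Nat.even_mul_succ_self k).neg_one_pow, mul_one]
  · have : prepend ([] : List (Option β)) = LinearMap.id := words_ext fun l => by simp
    simp [this]

/-- The span of the words of length `m` and weight `w` that begin with a letter. -/
noncomputable def leadSpan (β : Type*) (w m : ℕ) : Submodule ℚ (Words β) :=
  Finsupp.supported ℚ ℚ (wordSet β w m ∩ {l | ∃ x s, l = some x :: s})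

theorem leadSpan_le_wordSpan (w m : ℕ) : leadSpan β w m ≤ wordSpan β w m :=
  Finsupp.supported_mono Set.inter_subset_left

theorem leadSpan_le {w m : ℕ} {p : Submodule ℚ (Words β)}
    (h : ∀ x l, some x :: l ∈ wordSet β w m → Finsupp.single (some x :: l) 1 ∈ p) :
    leadSpan β w m ≤ p := by
  rw [leadSpan, Finsupp.supported_eq_span_single, Submodule.span_le]
  rintro _ ⟨l, ⟨hl, x, s, rfl⟩, rfl⟩
  exact h x s hl

theorem growHead_mem_wordSpan {w m : ℕ} {l : List (Option β)} (h : l ∈ wordSet β w m) :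
    growHead l ∈ wordSpan β w (m + 1) := by
  match l with
  | [] => exact Submodule.zero_mem _
  | none :: l => exact Submodule.zero_mem _
  | [some x] => exact Submodule.zero_mem _
  | some x :: some y :: l => exact Submodule.zero_mem _
  | some x :: none :: l =>
    refine single_mem_wordSpan ?_ 1
    simp only [wordSet, Set.mem_ofPred_eq, List.length_cons, List.countP_cons] at h ⊢
    exact ⟨by omega, h.2⟩

theorem consMap_none_mem_wordSpan {w m : ℕ} {r : Words β} (h : r ∈ wordSpan β w m) :
    consMap none r ∈ wordSpan β w (m + 1) := by
  suffices hs : wordSpan β w m ≤ (wordSpan β w (m + 1)).comap (consMap none) from hs h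
  rw [wordSpan, Finsupp.supported_eq_span_single, Submodule.span_le]
  rintro _ ⟨l, hl, rfl⟩
  rw [SetLike.mem_coe, Submodule.mem_comap, consMap_single]
  refine single_mem_wordSpan ?_ 1
  simpa [wordSet] using hl

theorem consMap_some_mem_leadSpan (x : β) {w m : ℕ} {r : Words β} (h : r ∈ wordSpan β w m) :
    consMap (some x) r ∈ leadSpan β (w + 1) (m + 1) := by
  suffices hs : wordSpan β w m ≤ (leadSpan β (w + 1) (m + 1)).comap (consMap (some x)) from hs h
  rw [wordSpan, Finsupp.supported_eq_span_single, Submodule.span_le]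
  rintro _ ⟨l, hl, rfl⟩
  rw [SetLike.mem_coe, Submodule.mem_comap, consMap_single]
  exact Finsupp.single_mem_supported ℚ 1 ⟨by simpa [wordSet] using hl, x, l, rfl⟩

theorem growWord_mem_wordSpan {w m : ℕ} {l : List (Option β)} (h : l ∈ wordSet β w m) :
    growWord l ∈ wordSpan β w (m + 1) := by
  induction l generalizing w m with
  | nil => exact Submodule.zero_mem _
  | cons a l ih =>
    refine Submodule.sub_mem _ (growHead_mem_wordSpan h) ?_
    obtain ⟨rfl, rfl⟩ := h
    match a with
    | none => exact consMap_none_mem_wordSpan (ih ⟨rfl, by simp⟩)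
    | some x =>
      refine leadSpan_le_wordSpan _ _ ?_
      rw [List.countP_cons, if_pos Option.isSome_some]
      exact consMap_some_mem_leadSpan x (ih ⟨rfl, rfl⟩)

theorem mem_leadSpan_of_supported {w m : ℕ} {r : Words β} (h : r ∈ wordSpan β w m)
    (h' : r ∈ Finsupp.supported ℚ ℚ {l : List (Option β) | ∃ x s, l = some x :: s}) :
    r ∈ leadSpan β w m := by
  rw [leadSpan, Finsupp.supported_inter]
  exact ⟨h, h'⟩

theorem consMap_some_mem_supported (x : β) (r : Words β) :
    consMap (some x) r ∈
      Finsupp.supported ℚ ℚ {l : List (Option β) | ∃ x s, l = some x :: s} := by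
  induction r using Finsupp.induction_linear with
  | zero => simp
  | add f g hf hg => rw [map_add]; exact Submodule.add_mem _ hf hg
  | single l c =>
    rw [consMap_single]
    exact Finsupp.single_mem_supported ℚ c ⟨x, l, rfl⟩

theorem mergeWord_some_mem_supported (x : β) (l : List (Option β)) :
    mergeWord (some x :: l) ∈
      Finsupp.supported ℚ ℚ {l : List (Option β) | ∃ x s, l = some x :: s} := by
  match l with
  | [] => exact Submodule.zero_mem _
  | c :: l =>
    rw [mergeWord]
    exact Submodule.neg_mem _ (consMap_some_mem_supported x _)

theorem growWord_some_mem_supported (x : β) (l : List (Option β)) :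
    growWord (some x :: l) ∈
      Finsupp.supported ℚ ℚ {l : List (Option β) | ∃ x s, l = some x :: s} := by
  refine Submodule.sub_mem _ ?_ (consMap_some_mem_supported x _)
  match l with
  | [] => exact Submodule.zero_mem _
  | some y :: l => exact Submodule.zero_mem _
  | none :: l => exact Finsupp.single_mem_supported ℚ 1 ⟨x, none :: none :: l, rfl⟩

theorem grow_mem_leadSpan {w m : ℕ} {r : Words β} (h : r ∈ leadSpan β w m) :
    grow r ∈ leadSpan β w (m + 1) := by
  refine (leadSpan_le fun x l hl => ?_ : _ ≤ (leadSpan β w (m + 1)).comap grow) h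
  rw [Submodule.mem_comap, grow_single]
  exact mem_leadSpan_of_supported (growWord_mem_wordSpan hl) (growWord_some_mem_supported x l)

/-- Modulo rotation `grow` is `growFirst` after the norm, so it factors through a map that vanishes
on `r`. This replaces compatibility of `grow` with the passage to coinvariants. -/
theorem grow_mem_turnSpan {w m : ℕ} {r : Words β} (h : r ∈ leadSpan β w m)
    (h0 : ∑ k ∈ Finset.range m, (turn ^ k) r = 0) : grow r ∈ turnSpan β w (m + 1) := by
  have h1 : leadSpan β w m ≤ (turnSpan β w (m + 1)).comap
      (growFirst ∘ₗ (∑ k ∈ Finset.range m, turn ^ k) - grow) :=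
    leadSpan_le fun x l hl => by
      simpa [LinearMap.sum_apply] using growFirst_turn_sum_mem w m x l hl
  have h2 := h1 h
  rw [Submodule.mem_comap, LinearMap.sub_apply, LinearMap.comp_apply, LinearMap.sum_apply, h0,
    map_zero, zero_sub] at h2
  exact (Submodule.neg_mem_iff _).1 h2

theorem runs_apply (r : Words β) (l : List (Option β)) : runs r l = runCount l * r l := by
  induction r using Finsupp.induction_linear with
  | zero => simp
  | add f g hf hg => rw [map_add, Finsupp.add_apply, hf, hg, Finsupp.add_apply, mul_add]
  | single s c =>
    classical
    rw [← mul_one c, ← smul_eq_mul, ← Finsupp.smul_single, map_smul, runs_single]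
    simp only [Finsupp.smul_apply, Finsupp.single_apply, smul_eq_mul]
    split_ifs with h
    · rw [h]; ring
    · simp

theorem runs_mem_supported {S : Set (List (Option β))} {r : Words β}
    (h : r ∈ Finsupp.supported ℚ ℚ S) : runs r ∈ Finsupp.supported ℚ ℚ S := by
  rw [Finsupp.mem_supported'] at h ⊢
  intro l hl
  rw [runs_apply, h l hl, mul_zero]

theorem runCount_cons_some_pos (x : β) (l : List (Option β))
    (h : l.countP Option.isSome < l.length) : 0 < runCount (some x :: l) := by
  induction l generalizing x with
  | nil => simp at h
  | cons a l ih =>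
    match a with
    | none => simp [runCount]
    | some y =>
      rw [runCount]
      · exact ih y (by simpa using h)
      · simp

/-- A word longer than its weight contains a one; if it begins with a letter, its first one follows
a letter. Hence the diagonal entries of `runs` are nonzero here. -/
theorem eq_zero_of_runs_eq_zero {w m : ℕ} (hw : w < m) {r : Words β} (h : r ∈ leadSpan β w m)
    (h0 : runs r = 0) : r = 0 := by
  ext l
  by_cases hl : l ∈ wordSet β w m ∩ {l | ∃ x s, l = some x :: s}
  · obtain ⟨⟨h1, h2⟩, x, s, rfl⟩ := hl
    have h3 := DFunLike.congr_fun h0 (some x :: s)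
    rw [runs_apply, Finsupp.zero_apply, mul_eq_zero, Nat.cast_eq_zero] at h3
    refine h3.resolve_left (runCount_cons_some_pos x s ?_).ne'
    simp only [List.length_cons, List.countP_cons, Option.isSome_some, if_true] at h1 h2
    omega
  · exact (Finsupp.mem_supported' ℚ r).1 h l hl

end Rotation

/-! ### The bar boundary of a word compared with merging. -/

section JoinWord

variable {β : Type*}

/-- The product of the first two letters of a word, followed by the rest of the word. -/
noncomputable def mulHead : Option β → Option β → List (Option β) → Words β
  | none, c, l => Finsupp.single (c :: l) 1
  | some x, none, l => Finsupp.single (some x :: l) 1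
  | some _, some _, _ => 0

/-- The bar boundary of a word. -/
noncomputable def joinWord : List (Option β) → Words β
  | [] => 0
  | [_] => 0
  | a :: c :: l => mulHead a c l - consMap a (joinWord (c :: l))

/-- The signed deletion of the last letter of a word if it is a one. -/
noncomputable def dropLastWord : List (Option β) → Words β
  | [] => 0
  | [none] => Finsupp.single [] 1
  | [some _] => 0
  | a :: c :: l => - consMap a (dropLastWord (c :: l))

/-- The deletion of the first letter of a word if it is a one. -/
noncomputable def dropFirstWord : List (Option β) → Words β
  | none :: l => Finsupp.single l 1
  | _ => 0

/-- All faces that touch a given run of ones delete a one from it, with alternating signs. For a run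
of `k` ones between two letters the full sum has `k + 1` terms and the sum of the inner ones `k - 1`
terms, starting with the opposite sign, so they are negatives of each other. The two drop terms
supply the missing faces at the ends of the word. -/
theorem joinWord_add_dropLastWord (a : Option β) (l : List (Option β)) :
    joinWord (a :: l) + dropLastWord (a :: l) = dropFirstWord (a :: l) - mergeWord (a :: l) := by
  induction l generalizing a with
  | nil => cases a <;> simp [joinWord, dropLastWord, dropFirstWord, mergeWord]
  | cons c l ih =>
    have h := congrArg (consMap a) (ih c)
    rw [map_add, map_sub] at h
    rw [joinWord, dropLastWord, sub_add, sub_neg_eq_add, h]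
    match a, c with
    | none, none => simp [mulHead, dropFirstWord, mergeWord]
    | none, some x => simp [mulHead, dropFirstWord, mergeWord]
    | some x, none => simp [mulHead, dropFirstWord, mergeWord]
    | some x, some y => simp [mulHead, dropFirstWord, mergeWord]

theorem dropLastWord_append (l : List (Option β)) (a : Option β) :
    dropLastWord (l ++ [a]) =
      if a.isSome then 0 else (-1 : ℚ) ^ l.length • Finsupp.single l 1 := by
  induction l with
  | nil => cases a <;> simp [dropLastWord]
  | cons c l ih =>
    have h : dropLastWord (c :: (l ++ [a])) = - consMap c (dropLastWord (l ++ [a])) := by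
      cases l <;> simp [dropLastWord]
    rw [List.cons_append, h, ih]
    cases a <;> simp [pow_succ]

end JoinWord

/-! ### The basis of tensor monomials, and chains as combinations of words. -/

section TruncPolyBasis

open MvPolynomial

variable (d : ℕ)

theorem mono_mul (a c : Option (Fin d)) :
    mono ℚ d a * mono ℚ d c = if a.isSome ∧ c.isSome then 0 else mono ℚ d (a.or c) := by
  cases a <;> cases c <;> simp [mono_mul_mono] <;> simp [mono]

/-- The homomorphism from `ℚ[x₁, …, x_d] / 𝔪²` to the trivial square-zero extension. -/
noncomputable def toTriv : TruncPoly ℚ d →ₐ[ℚ] TrivSqZeroExt ℚ (Fin d → ℚ) :=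
  Ideal.Quotient.liftₐ _ (aeval fun i => TrivSqZeroExt.inr (Pi.single i 1)) (by
    -- The ideal `𝔪` lands in the kernel of `fst`, and products of two elements of that kernel
    -- vanish, so `𝔪²` is killed.
    have h1 : Ideal.span (Set.range (X : Fin d → MvPolynomial (Fin d) ℚ)) ≤
        (RingHom.ker (TrivSqZeroExt.fstHom ℚ ℚ (Fin d → ℚ))).comap
          (aeval fun i => TrivSqZeroExt.inr (Pi.single i 1)) := by
      rw [Ideal.span_le]
      rintro _ ⟨i, rfl⟩
      simp [RingHom.mem_ker]
    suffices h : Ideal.span (Set.range (X : Fin d → MvPolynomial (Fin d) ℚ)) ^ 2 ≤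
        RingHom.ker (aeval fun i => (TrivSqZeroExt.inr (Pi.single i 1) :
          TrivSqZeroExt ℚ (Fin d → ℚ))) from fun a ha => h ha
    rw [pow_two, Ideal.mul_le]
    intro r hr s hs
    have hr' := h1 hr
    have hs' := h1 hs
    simp only [Ideal.mem_comap, RingHom.mem_ker, TrivSqZeroExt.fstHom_apply] at hr' hs'
    rw [RingHom.mem_ker, map_mul]
    ext
    · simp [hr']
    · simp [hr', hs'])

theorem toTriv_mono_none : toTriv d (mono ℚ d none) = 1 := map_one _

theorem toTriv_mono_some (i : Fin d) :
    toTriv d (mono ℚ d (some i)) = TrivSqZeroExt.inr (Pi.single i 1) := by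
  have : toTriv d (Ideal.Quotient.mk _ (X i)) =
      aeval (fun i => TrivSqZeroExt.inr (Pi.single i 1)) (X i : MvPolynomial (Fin d) ℚ) := rfl
  rw [mono, this, aeval_X]

/-- The images in the square-zero extension are `1` and the standard basis vectors, so the
coefficients can be read off from `fst` and `snd`. -/
theorem linearIndependent_mono : LinearIndependent ℚ (mono ℚ d) := by
  rw [Fintype.linearIndependent_iff]
  intro g hg
  have h := congrArg (toTriv d) hg
  rw [Fintype.sum_option, map_add, map_sum, map_smul, toTriv_mono_none, map_zero] at h
  simp only [map_smul, toTriv_mono_some] at h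
  have h1 := congrArg TrivSqZeroExt.fst h
  have h2 := congrArg TrivSqZeroExt.snd h
  rintro (_ | i)
  · simpa [TrivSqZeroExt.fst_sum] using h1
  · have h3 := congrFun h2 i
    simpa [TrivSqZeroExt.snd_sum, Finset.sum_apply, Pi.single_apply] using h3

theorem span_mono : ⊤ ≤ Submodule.span ℚ (Set.range (mono ℚ d)) := by
  rintro a -
  obtain ⟨p, rfl⟩ := Ideal.Quotient.mk_surjective a
  induction p using MvPolynomial.induction_on with
  | C c =>
    have : (Ideal.Quotient.mk _ (C c) : TruncPoly ℚ d) = c • mono ℚ d none := by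
      rw [mono, ← Algebra.algebraMap_eq_smul_one]; rfl
    rw [this]
    exact Submodule.smul_mem _ _ (Submodule.subset_span ⟨_, rfl⟩)
  | add p q hp hq => rw [map_add]; exact Submodule.add_mem _ hp hq
  | mul_X p i hp =>
    rw [map_mul]
    refine (Submodule.span_le.2 ?_ : _ ≤ (Submodule.span ℚ (Set.range (mono ℚ d))).comap
      (LinearMap.mulRight ℚ (mono ℚ d (some i)))) hp
    rintro _ ⟨c, rfl⟩
    rw [SetLike.mem_coe, Submodule.mem_comap, LinearMap.mulRight_apply, mono_mul]
    split_ifs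
    · exact Submodule.zero_mem _
    · exact Submodule.subset_span ⟨_, rfl⟩

/-- The basis `1, x₁, …, x_d` of `ℚ[x₁, …, x_d] / 𝔪²`. -/
noncomputable def monoBasis : Module.Basis (Option (Fin d)) ℚ (TruncPoly ℚ d) :=
  Module.Basis.mk (linearIndependent_mono d) (span_mono d)

/-- The basis of tensor monomials. -/
noncomputable def chainBasis (n : ℕ) :
    Module.Basis (Fin (n + 1) → Option (Fin d)) ℚ (Chain ℚ (TruncPoly ℚ d) n) :=
  Basis.piTensorProduct fun _ => monoBasis d

/-- The tensor monomial of a word. -/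
noncomputable abbrev tmono {n : ℕ} (v : Fin (n + 1) → Option (Fin d)) :
    Chain ℚ (TruncPoly ℚ d) n := PiTensorProduct.tprod ℚ fun j => mono ℚ d (v j)

@[simp] theorem chainBasis_apply (n : ℕ) (v : Fin (n + 1) → Option (Fin d)) :
    chainBasis d n v = tmono d v := by
  simp [chainBasis, monoBasis]

instance (n : ℕ) : Module.Finite ℚ (Chain ℚ (TruncPoly ℚ d) n) :=
  Module.Finite.of_basis (chainBasis d n)

theorem chain_ext {n : ℕ} {M : Type*} [AddCommGroup M] [Module ℚ M]
    {f g : Chain ℚ (TruncPoly ℚ d) n →ₗ[ℚ] M} (h : ∀ v, f (tmono d v) = g (tmono d v)) : f = g :=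
  (chainBasis d n).ext fun v => by simpa using h v

/-- The expansion of a chain in tensor monomials, as a combination of words. -/
noncomputable def toWords (n : ℕ) : Chain ℚ (TruncPoly ℚ d) n →ₗ[ℚ] Words (Fin d) :=
  (chainBasis d n).constr ℚ fun v => Finsupp.single (List.ofFn v) 1

/-- The chain with a given expansion in words of length `n + 1`. -/
noncomputable def ofWords (n : ℕ) : Words (Fin d) →ₗ[ℚ] Chain ℚ (TruncPoly ℚ d) n :=
  Finsupp.linearCombination ℚ fun l => tmono d fun j : Fin (n + 1) => l.getD j none

@[simp] theorem toWords_tmono {n : ℕ} (v : Fin (n + 1) → Option (Fin d)) :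
    toWords d n (tmono d v) = Finsupp.single (List.ofFn v) 1 := by
  rw [← chainBasis_apply, toWords, Module.Basis.constr_basis]

theorem ofWords_single_ofFn {n : ℕ} (v : Fin (n + 1) → Option (Fin d)) :
    ofWords d n (Finsupp.single (List.ofFn v) 1) = tmono d v := by
  rw [ofWords, Finsupp.linearCombination_single, one_smul]
  congr 1
  funext j
  rw [List.getD_eq_getElem _ _ (by rw [List.length_ofFn]; exact j.2), List.getElem_ofFn]

@[simp] theorem ofWords_toWords {n : ℕ} (y : Chain ℚ (TruncPoly ℚ d) n) :
    ofWords d n (toWords d n y) = y := by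
  suffices h : ofWords d n ∘ₗ toWords d n = LinearMap.id from LinearMap.congr_fun h y
  refine chain_ext d fun v => ?_
  rw [LinearMap.comp_apply, toWords_tmono, ofWords_single_ofFn, LinearMap.id_apply]

theorem exists_ofFn {n : ℕ} {α : Type*} (l : List α) (h : l.length = n) :
    ∃ v : Fin n → α, l = List.ofFn v := by
  subst h
  exact ⟨l.get, (List.ofFn_get l).symm⟩

theorem card_filter_isSome {n : ℕ} {α : Type*} (v : Fin n → Option α) :
    (Finset.univ.filter fun j => (v j).isSome).card = (List.ofFn v).countP Option.isSome := by
  induction n with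
  | zero => simp
  | succ n ih =>
    rw [List.ofFn_succ, List.countP_cons, ← ih, Finset.card_filter, Fin.sum_univ_succ,
      Finset.card_filter, add_comm]

theorem ofFn_mem_wordSet {w n : ℕ} {β : Type*} (v : Fin n → Option β) :
    List.ofFn v ∈ wordSet β w n ↔ (Finset.univ.filter fun j => (v j).isSome).card = w := by
  rw [card_filter_isSome]
  simp [wordSet]

theorem weightPart_le {w n : ℕ} {p : Submodule ℚ (Chain ℚ (TruncPoly ℚ d) n)}
    (h : ∀ v, List.ofFn v ∈ wordSet (Fin d) w (n + 1) → tmono d v ∈ p) :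
    weightPart ℚ d w n ≤ p := by
  rw [weightPart, Submodule.span_le]
  rintro _ ⟨v, hv, rfl⟩
  exact h v ((ofFn_mem_wordSet v).2 hv)

theorem tmono_mem {w n : ℕ} {v : Fin (n + 1) → Option (Fin d)}
    (h : List.ofFn v ∈ wordSet (Fin d) w (n + 1)) : tmono d v ∈ weightPart ℚ d w n :=
  Submodule.subset_span ⟨v, (ofFn_mem_wordSet v).1 h, rfl⟩

theorem toWords_mem {w n : ℕ} {y : Chain ℚ (TruncPoly ℚ d) n} (hy : y ∈ weightPart ℚ d w n) :
    toWords d n y ∈ wordSpan (Fin d) w (n + 1) :=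
  (weightPart_le d fun v hv => by
    rw [Submodule.mem_comap, toWords_tmono]
    exact single_mem_wordSpan hv 1 : _ ≤ (wordSpan (Fin d) w (n + 1)).comap (toWords d n)) hy

theorem exists_toWords_eq {w n : ℕ} {r : Words (Fin d)} (hr : r ∈ wordSpan (Fin d) w (n + 1)) :
    ∃ y ∈ weightPart ℚ d w n, toWords d n y = r := by
  suffices h : wordSpan (Fin d) w (n + 1) ≤ (weightPart ℚ d w n).map (toWords d n) from h hr
  rw [wordSpan, Finsupp.supported_eq_span_single, Submodule.span_le]
  rintro _ ⟨l, hl, rfl⟩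
  obtain ⟨v, rfl⟩ := exists_ofFn l hl.1
  exact ⟨tmono d v, tmono_mem d hl, toWords_tmono d v⟩

theorem toWords_injective (n : ℕ) : Function.Injective (toWords d n) :=
  Function.LeftInverse.injective (ofWords_toWords d)

/-- `turn` and `t` rotate in opposite directions, with signs `(-1)^{n+2}` and `(-1)^n` on `n + 1`
factors. `turn` thus corresponds to `t⁻¹`, and both have the same coinvariants. -/
theorem turn_toWords_t {n : ℕ} (y : Chain ℚ (TruncPoly ℚ d) n) :
    turn (toWords d n (t ℚ (TruncPoly ℚ d) n y)) = toWords d n y := by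
  suffices h : turn ∘ₗ toWords d n ∘ₗ t ℚ (TruncPoly ℚ d) n = toWords d n from
    LinearMap.congr_fun h y
  refine chain_ext d fun v => ?_
  have h1 : t ℚ (TruncPoly ℚ d) n (tmono d v) =
      (-1 : ℚ) ^ n • tmono d fun j => v ((finRotate (n + 1)).symm j) := by
    rw [t, LinearMap.smul_apply, rot_tprod]
  have h2 : (List.ofFn fun j => v ((finRotate (n + 1)).symm j)).rotate 1 = List.ofFn v := by
    refine List.ext_getElem (by simp) fun i hi hi' => ?_
    simp only [List.length_ofFn, List.length_rotate] at hi hi'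
    simp only [List.getElem_rotate, List.getElem_ofFn, List.length_ofFn, finRotate_symm_mk]
    congr 2
    rcases Nat.lt_or_ge (i + 1) (n + 1) with h | h
    · simp [Nat.mod_eq_of_lt h]
    · obtain rfl : i = n := by omega
      simp
  rw [LinearMap.comp_apply, LinearMap.comp_apply, h1, map_smul, map_smul, toWords_tmono,
    turn_single, h2, toWords_tmono, List.length_ofFn, smul_smul, ← pow_add,
    show n + (n + 1 + 1) = 2 * (n + 1) by ring, pow_mul]
  simp

end TruncPolyBasis

/-! ### The boundaries `b'` and `b` on words. -/

section Faces

variable (d : ℕ)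

/-- A face of a monomial is zero or again a monomial, so identities between faces can be checked on
words. -/
theorem faceFun_mono {n : ℕ} (i : ℕ) (hi : i < n + 1) (v : Fin (n + 2) → Option (Fin d)) :
    (∃ j, faceFun (n := n) ⟨i, by omega⟩ (fun j => mono ℚ d (v j)) j = 0) ∨
      ∃ u : Fin (n + 1) → Option (Fin d),
        (faceFun (n := n) ⟨i, by omega⟩ fun j => mono ℚ d (v j)) = fun j => mono ℚ d (u j) := by
  by_cases h : (v ⟨i, by omega⟩).isSome ∧ (v ⟨i + 1, by omega⟩).isSome
  · left
    refine ⟨⟨i, hi⟩, ?_⟩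
    rw [faceFun_mk, if_neg (by omega), if_neg (by omega), if_pos rfl, mono_mul, if_pos h]
  · right
    refine ⟨fun j => if j.1 < i then v j.castSucc else if j.1 = i then
      (v ⟨i, by omega⟩).or (v ⟨i + 1, by omega⟩) else v j.succ, ?_⟩
    funext ⟨j, hj⟩
    rw [faceFun_mk, if_neg (by omega)]
    dsimp only
    split_ifs with h1 h2
    · rfl
    · subst h2
      rw [mono_mul, if_neg h]
    · rfl

theorem faceFun_cons {n : ℕ} {A : Type*} [Ring A] (i : ℕ) (hi : i < n + 1) (a : A)
    (f : Fin (n + 2) → A) :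
    faceFun (n := n + 1) ⟨i + 1, by omega⟩ (Fin.cons a f) =
      Fin.cons a (faceFun (n := n) ⟨i, by omega⟩ f) := by
  funext j
  refine Fin.cases ?_ (fun j => ?_) j
  · rw [show (0 : Fin (n + 2)) = ⟨0, by omega⟩ from rfl, faceFun_mk]
    split_ifs <;> first | rfl | omega
  · obtain ⟨j, hj⟩ := j
    rw [Fin.cons_succ, Fin.succ_mk, faceFun_mk, faceFun_mk]
    split_ifs <;> first | rfl | omega

theorem toWords_cons {n : ℕ} (a : Option (Fin d)) (v : Fin (n + 1) → Option (Fin d)) :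
    toWords d (n + 1) (PiTensorProduct.tprod ℚ (Fin.cons (mono ℚ d a) fun j => mono ℚ d (v j))) =
      consMap a (toWords d n (tmono d v)) := by
  have h : (Fin.cons (mono ℚ d a) fun j => mono ℚ d (v j) : Fin (n + 2) → TruncPoly ℚ d) =
      fun j => mono ℚ d ((Fin.cons a v : Fin (n + 2) → Option (Fin d)) j) := by
    funext j
    exact Fin.cases rfl (fun j => rfl) j
  rw [h, toWords_tmono, toWords_tmono, consMap_single, List.ofFn_succ]
  rfl

theorem toWords_face_succ {n : ℕ} (i : ℕ) (hi : i < n + 1) (a : Option (Fin d))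
    (v : Fin (n + 2) → Option (Fin d)) :
    toWords d (n + 1) (face ℚ _ (n + 1) ⟨i + 1, by omega⟩
        (tmono d (Fin.cons a v : Fin (n + 3) → Option (Fin d)))) =
      consMap a (toWords d n (face ℚ _ n ⟨i, by omega⟩ (tmono d v))) := by
  have h : (fun j => mono ℚ d ((Fin.cons a v : Fin (n + 3) → Option (Fin d)) j)) =
      (Fin.cons (mono ℚ d a) fun j => mono ℚ d (v j) : Fin (n + 3) → TruncPoly ℚ d) := by
    funext j
    exact Fin.cases rfl (fun j => rfl) j
  rw [face_tprod, face_tprod, h, faceFun_cons i hi]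
  rcases faceFun_mono d i hi v with ⟨j, hj⟩ | ⟨u, hu⟩
  · rw [MultilinearMap.map_coord_zero _ j hj, MultilinearMap.map_coord_zero _ j.succ
      (by rw [Fin.cons_succ, hj]), map_zero, map_zero, map_zero]
  · rw [hu]
    exact toWords_cons d a u

theorem toWords_face_zero {n : ℕ} (v : Fin (n + 2) → Option (Fin d)) :
    toWords d n (face ℚ _ n ⟨0, by omega⟩ (tmono d v)) =
      mulHead (v 0) (v 1) (List.ofFn fun j : Fin n => v j.succ.succ) := by
  have h0 : faceFun (n := n) ⟨0, by omega⟩ (fun j => mono ℚ d (v j)) 0 =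
      mono ℚ d (v 0) * mono ℚ d (v 1) := by
    rw [show (0 : Fin (n + 1)) = ⟨0, by omega⟩ from rfl, faceFun_mk]
    simp
  have hs : ∀ j : Fin n, faceFun (n := n) ⟨0, by omega⟩ (fun j => mono ℚ d (v j)) j.succ =
      mono ℚ d (v j.succ.succ) := by
    intro ⟨j, hj⟩
    rw [Fin.succ_mk, faceFun_mk]
    simp
  rw [face_tprod]
  by_cases h : (v 0).isSome ∧ (v 1).isSome
  · rw [MultilinearMap.map_coord_zero _ 0 (by rw [h0, mono_mul, if_pos h]), map_zero]
    obtain ⟨x, hx⟩ := Option.isSome_iff_exists.1 h.1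
    obtain ⟨y, hy⟩ := Option.isSome_iff_exists.1 h.2
    rw [hx, hy, mulHead]
  · have h1 : faceFun (n := n) ⟨0, by omega⟩ (fun j => mono ℚ d (v j)) =
        fun j => mono ℚ d ((Fin.cons ((v 0).or (v 1)) fun j => v j.succ.succ :
          Fin (n + 1) → Option (Fin d)) j) := by
      funext j
      refine Fin.cases ?_ (fun j => ?_) j
      · rw [h0, mono_mul, if_neg h, Fin.cons_zero]
      · rw [hs, Fin.cons_succ]
    rw [h1, toWords_tmono, List.ofFn_succ]
    simp only [Fin.cons_zero, Fin.cons_succ]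
    cases h2 : v 0 <;> cases h3 : v 1 <;> simp_all [mulHead]

theorem toWords_b' {n : ℕ} (v : Fin (n + 2) → Option (Fin d)) :
    toWords d n (b' ℚ _ n (tmono d v)) = joinWord (List.ofFn v) := by
  induction n with
  | zero =>
    rw [b', Fin.sum_univ_one]
    simp only [Fin.val_zero, pow_zero, one_smul]
    rw [show (Fin.castSucc 0 : Fin 2) = ⟨0, by omega⟩ from rfl, toWords_face_zero]
    simp [List.ofFn_succ, joinWord]
  | succ n ih =>
    obtain ⟨a, u, rfl⟩ : ∃ (a : Option (Fin d)) (u : Fin (n + 2) → Option (Fin d)),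
        v = Fin.cons a u := ⟨v 0, Fin.tail v, (Fin.cons_self_tail v).symm⟩
    have h := ih u
    rw [b', LinearMap.sum_apply, map_sum] at h
    rw [b', LinearMap.sum_apply, map_sum, Fin.sum_univ_succ]
    have h1 : ∀ i : Fin (n + 1), toWords d (n + 1) (((-1 : ℚ) ^ (i.succ : ℕ) •
        face ℚ (TruncPoly ℚ d) (n + 1) i.succ.castSucc)
          (tmono d (Fin.cons a u : Fin (n + 3) → Option (Fin d)))) =
        - consMap a (toWords d n (((-1 : ℚ) ^ (i : ℕ) • face ℚ (TruncPoly ℚ d) n i.castSucc)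
          (tmono d u))) := by
      intro i
      rw [LinearMap.smul_apply, LinearMap.smul_apply, map_smul, map_smul, map_smul]
      have := toWords_face_succ d i.1 i.2 a u
      rw [show i.succ.castSucc = ⟨i.1 + 1, by omega⟩ from rfl, this, Fin.val_succ, pow_succ]
      simp only [mul_neg, mul_one, neg_smul]
      rfl
    rw [Finset.sum_congr rfl fun i _ => h1 i, Finset.sum_neg_distrib, ← map_sum, h]
    rw [LinearMap.smul_apply, Fin.val_zero, pow_zero, one_smul,
      show (Fin.castSucc 0 : Fin (n + 3)) = ⟨0, by omega⟩ from rfl, toWords_face_zero]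
    simp [List.ofFn_succ, joinWord, sub_eq_add_neg]

/-- When `v 0` is a letter, the cyclic product `aₙ₊₁ * a₀` vanishes for a letter `aₙ₊₁`, and for
`aₙ₊₁ = 1` it just deletes the last entry. -/
theorem toWords_face_last {n : ℕ} (v : Fin (n + 2) → Option (Fin d)) (h0 : (v 0).isSome) :
    (-1 : ℚ) ^ (n + 1) • toWords d n (face ℚ _ n (Fin.last (n + 1)) (tmono d v)) =
      dropLastWord (List.ofFn v) := by
  have h1 : List.ofFn v = (List.ofFn fun j : Fin (n + 1) => v j.castSucc) ++ [v (Fin.last _)] := by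
    rw [List.ofFn_succ', List.concat_eq_append]
  have hf : faceFun (n := n) (Fin.last (n + 1)) (fun j => mono ℚ d (v j)) 0 =
      mono ℚ d (v (Fin.last _)) * mono ℚ d (v 0) := by
    simp [faceFun]
  rw [h1, dropLastWord_append, face_tprod]
  split_ifs with h
  · rw [MultilinearMap.map_coord_zero _ 0 (by rw [hf, mono_mul, if_pos ⟨h, h0⟩]), map_zero,
      smul_zero]
  · have hlast : v (Fin.last _) = none := by simpa using h
    have h2 : faceFun (n := n) (Fin.last (n + 1)) (fun j => mono ℚ d (v j)) =
        fun j => mono ℚ d (v j.castSucc) := by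
      funext j
      refine Fin.cases ?_ (fun j => ?_) j
      · rw [hf, hlast, mono_mul]
        simp
      · obtain ⟨j, hj⟩ := j
        rw [Fin.succ_mk, show Fin.last (n + 1) = ⟨n + 1, by omega⟩ from rfl, faceFun_mk,
          if_neg (show ¬ (n + 1 = n + 1 ∧ j + 1 = 0) by omega),
          if_pos (show j + 1 < n + 1 by omega)]
        rfl
    rw [h2, toWords_tmono, List.length_ofFn]

theorem b_eq_b'_add (n : ℕ) : b ℚ (TruncPoly ℚ d) n =
    b' ℚ _ n + (-1 : ℚ) ^ (n + 1) • face ℚ _ n (Fin.last (n + 1)) := by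
  rw [b, b', Fin.sum_univ_castSucc]
  rfl

/-- On tensor monomials beginning with a letter, the Hochschild boundary is minus the merging of
adjacent ones. -/
theorem toWords_b {n : ℕ} (v : Fin (n + 2) → Option (Fin d)) (h0 : (v 0).isSome) :
    toWords d n (b ℚ _ n (tmono d v)) = - mergeWord (List.ofFn v) := by
  rw [b_eq_b'_add, LinearMap.add_apply, LinearMap.smul_apply, map_add, map_smul, toWords_b',
    toWords_face_last d v h0, List.ofFn_succ, joinWord_add_dropLastWord]
  obtain ⟨x, hx⟩ := Option.isSome_iff_exists.1 h0
  rw [hx]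
  simp [dropFirstWord]

end Faces

/-! ### Acyclicity of the coinvariants above the critical degree. -/

section Connes

variable (d : ℕ)

/-- The weight `w` chains that vanish in the coinvariants of the cyclic operator. -/
noncomputable def tSpan (w n : ℕ) : Submodule ℚ (Chain ℚ (TruncPoly ℚ d) n) :=
  (weightPart ℚ d w n).map (1 - t ℚ (TruncPoly ℚ d) n)

/-- The span of the tensor monomials of weight `w` that begin with a letter. -/
noncomputable def leadPart (w n : ℕ) : Submodule ℚ (Chain ℚ (TruncPoly ℚ d) n) :=
  (leadSpan (Fin d) w (n + 1)).comap (toWords d n)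

theorem t_t_pow (n : ℕ) (y : Chain ℚ (TruncPoly ℚ d) n) :
    t ℚ (TruncPoly ℚ d) n ((t ℚ (TruncPoly ℚ d) n ^ n) y) = y := by
  rw [← Module.End.mul_apply, ← pow_succ', t_pow_card, Module.End.one_apply]

theorem turn_toWords {n : ℕ} (y : Chain ℚ (TruncPoly ℚ d) n) :
    turn (toWords d n y) = toWords d n ((t ℚ (TruncPoly ℚ d) n ^ n) y) := by
  have h := turn_toWords_t d ((t ℚ (TruncPoly ℚ d) n ^ n) y)
  rwa [t_t_pow] at h

theorem mem_tSpan_of_toWords {w n : ℕ} {y : Chain ℚ (TruncPoly ℚ d) n}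
    (h : toWords d n y ∈ turnSpan (Fin d) w (n + 1)) : y ∈ tSpan d w n := by
  obtain ⟨r, hr, hry⟩ := h
  obtain ⟨u, hu, rfl⟩ := exists_toWords_eq d hr
  -- With `turn = t⁻¹ = tⁿ`, the chain is `(1 - t⁻¹) u = (1 - t)(-t⁻¹ u)`.
  refine ⟨-((t ℚ (TruncPoly ℚ d) n ^ n) u), Submodule.neg_mem _ (t_pow_mem ℚ d w n n hu), ?_⟩
  apply toWords_injective
  rw [← hry, LinearMap.sub_apply, LinearMap.sub_apply, Module.End.one_apply, Module.End.one_apply,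
    turn_toWords, map_neg, t_t_pow, sub_neg_eq_add, map_add, map_neg]
  abel

theorem mem_weightPart_of_toWords {w n : ℕ} {y : Chain ℚ (TruncPoly ℚ d) n}
    (h : toWords d n y ∈ wordSpan (Fin d) w (n + 1)) : y ∈ weightPart ℚ d w n := by
  obtain ⟨u, hu, h1⟩ := exists_toWords_eq d h
  rwa [← toWords_injective d n h1]

theorem leadPart_le_weightPart (w n : ℕ) : leadPart d w n ≤ weightPart ℚ d w n :=
  fun _ hy => mem_weightPart_of_toWords d (leadSpan_le_wordSpan _ _ hy)

theorem leadPart_le {w n : ℕ} {p : Submodule ℚ (Chain ℚ (TruncPoly ℚ d) n)}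
    (h : ∀ v, List.ofFn v ∈ wordSet (Fin d) w (n + 1) → (v 0).isSome → tmono d v ∈ p) :
    leadPart d w n ≤ p := by
  intro y hy
  have h1 : leadSpan (Fin d) w (n + 1) ≤ p.map (toWords d n) := by
    refine leadSpan_le fun x l hl => ?_
    obtain ⟨v, hv⟩ := exists_ofFn _ hl.1
    rw [hv] at hl ⊢
    refine ⟨tmono d v, h v hl ?_, toWords_tmono d v⟩
    rw [List.ofFn_succ, List.cons.injEq] at hv
    rw [← hv.1]
    rfl
  obtain ⟨u, hu, h2⟩ := h1 hy
  rwa [← toWords_injective d n h2]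

/-- A word of positive weight contains a letter; swapping the part before it to the end yields a
word that begins with a letter and has the same class up to sign. -/
theorem exists_sub_mem_tSpan {w n : ℕ} (hw : 0 < w) {y : Chain ℚ (TruncPoly ℚ d) n}
    (hy : y ∈ weightPart ℚ d w n) : ∃ u ∈ leadPart d w n, y - u ∈ tSpan d w n := by
  suffices h : weightPart ℚ d w n ≤ leadPart d w n ⊔ tSpan d w n by
    obtain ⟨u, hu, z, hz, rfl⟩ := Submodule.mem_sup.1 (h hy)
    exact ⟨u, hu, by simpa using hz⟩
  refine weightPart_le d fun v hv => ?_
  obtain ⟨a, ha, hx⟩ : ∃ a ∈ List.ofFn v, a.isSome :=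
    List.countP_pos_iff.1 (hv.2.symm ▸ hw)
  obtain ⟨x, rfl⟩ := Option.isSome_iff_exists.1 hx
  obtain ⟨p, s, hps⟩ := List.append_of_mem ha
  have h1 := single_sub_swap_mem w (n + 1) p (some x :: s) (hps ▸ hv)
  have h2 : some x :: s ++ p ∈ wordSet (Fin d) w (n + 1) := by
    rw [hps] at hv
    simp only [wordSet, Set.mem_ofPred_eq, List.length_append, List.countP_append] at hv ⊢
    omega
  obtain ⟨u, hu, h3⟩ := exists_toWords_eq d (single_mem_wordSpan h2 1)
  rw [← hps, ← toWords_tmono, ← h3, ← map_smul, ← map_sub] at h1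
  refine Submodule.mem_sup.2 ⟨_, ?_, _, mem_tSpan_of_toWords d h1, add_sub_cancel _ _⟩
  refine Submodule.smul_mem _ _ ?_
  rw [leadPart, Submodule.mem_comap, h3]
  exact Finsupp.single_mem_supported ℚ 1 ⟨h2, x, s ++ p, rfl⟩

/-- Insertion of ones into the runs of ones, on chains. -/
noncomputable def growChain (n : ℕ) :
    Chain ℚ (TruncPoly ℚ d) n →ₗ[ℚ] Chain ℚ (TruncPoly ℚ d) (n + 1) :=
  ofWords d (n + 1) ∘ₗ grow ∘ₗ toWords d n

/-- The operator multiplying a tensor monomial with its number of runs of ones. -/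
noncomputable def runsChain (n : ℕ) : Module.End ℚ (Chain ℚ (TruncPoly ℚ d) n) :=
  ofWords d n ∘ₗ runs ∘ₗ toWords d n

theorem toWords_ofWords {w n : ℕ} {r : Words (Fin d)} (hr : r ∈ wordSpan (Fin d) w (n + 1)) :
    toWords d n (ofWords d n r) = r := by
  obtain ⟨u, hu, rfl⟩ := exists_toWords_eq d hr
  rw [ofWords_toWords]

theorem toWords_growChain {w n : ℕ} {y : Chain ℚ (TruncPoly ℚ d) n} (hy : y ∈ leadPart d w n) :
    toWords d (n + 1) (growChain d n y) = grow (toWords d n y) :=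
  toWords_ofWords d (leadSpan_le_wordSpan _ _ (grow_mem_leadSpan hy))

theorem growChain_mem {w n : ℕ} {y : Chain ℚ (TruncPoly ℚ d) n} (hy : y ∈ leadPart d w n) :
    growChain d n y ∈ leadPart d w (n + 1) := by
  rw [leadPart, Submodule.mem_comap, toWords_growChain d hy]
  exact grow_mem_leadSpan hy

theorem toWords_runsChain {w n : ℕ} {y : Chain ℚ (TruncPoly ℚ d) n} (hy : y ∈ leadPart d w n) :
    toWords d n (runsChain d n y) = runs (toWords d n y) :=
  toWords_ofWords d (leadSpan_le_wordSpan _ _ (runs_mem_supported hy))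

theorem runsChain_mem {w n : ℕ} {y : Chain ℚ (TruncPoly ℚ d) n} (hy : y ∈ leadPart d w n) :
    runsChain d n y ∈ leadPart d w n := by
  rw [leadPart, Submodule.mem_comap, toWords_runsChain d hy]
  exact runs_mem_supported hy

theorem toWords_b_lead {w n : ℕ} {y : Chain ℚ (TruncPoly ℚ d) (n + 1)}
    (hy : y ∈ leadPart d w (n + 1)) :
    toWords d n (b ℚ _ n y) = - merge (toWords d (n + 1) y) := by
  have h : leadPart d w (n + 1) ≤
      LinearMap.ker (toWords d n ∘ₗ b ℚ _ n + merge ∘ₗ toWords d (n + 1)) :=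
    leadPart_le d fun v _ h0 => by simp [toWords_b d v h0]
  exact eq_neg_of_add_eq_zero_left (h hy)

theorem b_mem {w n : ℕ} {y : Chain ℚ (TruncPoly ℚ d) (n + 1)}
    (hy : y ∈ weightPart ℚ d w (n + 1)) : b ℚ _ n y ∈ weightPart ℚ d w n := by
  simpa [vert] using vert_mem ℚ d w 0 n hy

theorem b'_mem {w n : ℕ} {y : Chain ℚ (TruncPoly ℚ d) (n + 1)}
    (hy : y ∈ weightPart ℚ d w (n + 1)) : b' ℚ _ n y ∈ weightPart ℚ d w n := by
  simpa [vert] using vert_mem ℚ d w 1 n hy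

theorem b_mem_leadPart {w n : ℕ} {y : Chain ℚ (TruncPoly ℚ d) (n + 1)}
    (hy : y ∈ leadPart d w (n + 1)) : b ℚ _ n y ∈ leadPart d w n := by
  refine mem_leadSpan_of_supported (toWords_mem d (b_mem d (leadPart_le_weightPart d _ _ hy))) ?_
  rw [toWords_b_lead d hy]
  refine Submodule.neg_mem _ ?_
  refine (leadSpan_le fun x l _ => ?_ : _ ≤ (Finsupp.supported ℚ ℚ
    {l : List (Option (Fin d)) | ∃ x s, l = some x :: s}).comap merge) hy
  rw [Submodule.mem_comap, merge_single]
  exact mergeWord_some_mem_supported x l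

theorem turn_pow_toWords_t_pow (n k : ℕ) (y : Chain ℚ (TruncPoly ℚ d) n) :
    (turn ^ k) (toWords d n ((t ℚ (TruncPoly ℚ d) n ^ k) y)) = toWords d n y := by
  induction k with
  | zero => simp
  | succ k ih =>
    rw [pow_succ turn, pow_succ' (t ℚ (TruncPoly ℚ d) n), Module.End.mul_apply,
      Module.End.mul_apply, turn_toWords_t, ih]

theorem turn_sum_eq_zero {n : ℕ} {y : Chain ℚ (TruncPoly ℚ d) n} (hy : N ℚ _ n y = 0) :
    ∑ k ∈ Finset.range (n + 1), (turn ^ k) (toWords d n y) = 0 := by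
  -- Applying `turnⁿ` turns the powers `t^k` of the norm into `turn^{n-k}`; reversing the sum gives
  -- the norm of `turn`.
  have h := congrArg (fun z => (turn ^ n) (toWords d n z)) hy
  simp only [map_zero, N, LinearMap.sum_apply, map_sum] at h
  rw [← h, ← Finset.sum_range_reflect]
  refine Finset.sum_congr rfl fun k hk => ?_
  have hk' := Finset.mem_range.1 hk
  rw [show turn (β := Fin d) ^ n = turn ^ (n + 1 - 1 - k) * turn ^ k by
    rw [← pow_add]; congr 1; omega, Module.End.mul_apply, turn_pow_toWords_t_pow]

theorem growChain_b_mem_tSpan {w n : ℕ} {y : Chain ℚ (TruncPoly ℚ d) (n + 1)}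
    (hy : y ∈ leadPart d w (n + 1)) (h0 : N ℚ _ n (b ℚ _ n y) = 0) :
    growChain d n (b ℚ _ n y) ∈ tSpan d w (n + 1) := by
  apply mem_tSpan_of_toWords
  rw [toWords_growChain d (b_mem_leadPart d hy)]
  exact grow_mem_turnSpan (b_mem_leadPart d hy) (turn_sum_eq_zero d h0)

/-- The homotopy identity transported to chains; the two minus signs, from `b = -merge` and from
`-runs`, cancel. -/
theorem runsChain_eq {w n : ℕ} {y : Chain ℚ (TruncPoly ℚ d) (n + 1)}
    (hy : y ∈ leadPart d w (n + 1)) :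
    runsChain d (n + 1) y =
      b ℚ _ (n + 1) (growChain d (n + 1) y) + growChain d n (b ℚ _ n y) := by
  apply toWords_injective
  rw [map_add, toWords_runsChain d hy, toWords_b_lead d (growChain_mem d hy),
    toWords_growChain d hy, toWords_growChain d (b_mem_leadPart d hy), toWords_b_lead d hy,
    map_neg, ← neg_add, merge_grow_add_grow_merge, neg_neg]

theorem N_one_sub_t (n : ℕ) (y : Chain ℚ (TruncPoly ℚ d) n) :
    N ℚ _ n ((1 - t ℚ (TruncPoly ℚ d) n) y) = 0 :=
  LinearMap.congr_fun (N_mul_one_sub_t ℚ (TruncPoly ℚ d) n) y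

theorem b_one_sub_t (n : ℕ) (y : Chain ℚ (TruncPoly ℚ d) (n + 1)) :
    b ℚ _ n ((1 - t ℚ (TruncPoly ℚ d) (n + 1)) y) =
      (1 - t ℚ (TruncPoly ℚ d) n) (b' ℚ _ n y) :=
  LinearMap.congr_fun (b_comp_one_sub_t ℚ (TruncPoly ℚ d) n) y

theorem b_mem_tSpan {w n : ℕ} {y : Chain ℚ (TruncPoly ℚ d) (n + 1)}
    (hy : y ∈ tSpan d w (n + 1)) : b ℚ _ n y ∈ tSpan d w n := by
  obtain ⟨u, hu, rfl⟩ := hy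
  rw [b_one_sub_t]
  exact Submodule.mem_map_of_mem (b'_mem d hu)

theorem N_eq_zero_of_mem_tSpan {w n : ℕ} {y : Chain ℚ (TruncPoly ℚ d) n}
    (hy : y ∈ tSpan d w n) : N ℚ _ n y = 0 := by
  obtain ⟨u, hu, rfl⟩ := hy
  exact N_one_sub_t d n u

/-- In positive weight, the complex of coinvariants of the cyclic operator has no homology in
degrees at least the weight. -/
theorem exists_b_add_of_N_b_eq_zero {w n : ℕ} (hw : 0 < w) (hwn : w ≤ n + 1)
    {y : Chain ℚ (TruncPoly ℚ d) (n + 1)} (hy : y ∈ weightPart ℚ d w (n + 1))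
    (h0 : N ℚ _ n (b ℚ _ n y) = 0) :
    ∃ z ∈ weightPart ℚ d w (n + 2), y - b ℚ _ (n + 1) z ∈ tSpan d w (n + 1) := by
  obtain ⟨u, hu, huy⟩ := exists_sub_mem_tSpan d hw hy
  have hu0 : N ℚ _ n (b ℚ _ n u) = 0 := by
    have h1 := N_eq_zero_of_mem_tSpan d (b_mem_tSpan d huy)
    rwa [map_sub, map_sub, h0, zero_sub, neg_eq_zero] at h1
  -- Chains whose classes are cycles in the coinvariants. The condition `N (b y) = 0` is used as a
  -- linear form of `b y ∈ tSpan`.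
  let Z : Submodule ℚ (Chain ℚ (TruncPoly ℚ d) (n + 1)) :=
    leadPart d w (n + 1) ⊓ LinearMap.ker (N ℚ (TruncPoly ℚ d) n ∘ₗ b ℚ _ n)
  -- On `Z` the operator is `b ∘ grow` plus an element of `tSpan`, and both are cycles in the
  -- coinvariants.
  have hZ : ∀ y ∈ Z, runsChain d (n + 1) y ∈ Z := by
    rintro y ⟨hy1, hy2⟩
    refine ⟨runsChain_mem d hy1, ?_⟩
    have h1 := growChain_b_mem_tSpan d hy1 hy2
    have h2 := LinearMap.congr_fun (b_comp_b ℚ (TruncPoly ℚ d) n) (growChain d (n + 1) y)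
    simp only [LinearMap.comp_apply, LinearMap.zero_apply] at h2
    change N ℚ _ n (b ℚ _ n (runsChain d (n + 1) y)) = 0
    rw [runsChain_eq d hy1, map_add, h2, zero_add]
    exact N_eq_zero_of_mem_tSpan d (b_mem_tSpan d h1)
  have hinj : Function.Injective ((runsChain d (n + 1)).restrict hZ) := by
    rw [injective_iff_map_eq_zero]
    rintro ⟨y, hy⟩ h
    have h1 : runsChain d (n + 1) y = 0 := congrArg Subtype.val h
    have h2 := toWords_runsChain d hy.1
    rw [h1, map_zero] at h2
    have h3 := eq_zero_of_runs_eq_zero (by omega) hy.1 h2.symm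
    exact Subtype.ext (toWords_injective d _ (by simpa using h3))
  -- By finite dimension the run operator can be inverted inside `Z`. Then `u = b (grow z) + grow (b
  -- z)`, and the last summand lies in `tSpan`.
  obtain ⟨⟨z, hz⟩, hzu⟩ := LinearMap.surjective_of_injective hinj ⟨u, hu, hu0⟩
  have hzu' : runsChain d (n + 1) z = u := congrArg Subtype.val hzu
  refine ⟨growChain d (n + 1) z, leadPart_le_weightPart d _ _ (growChain_mem d hz.1), ?_⟩
  have h1 := growChain_b_mem_tSpan d hz.1 hz.2
  convert Submodule.add_mem _ huy h1 using 1
  rw [← hzu', runsChain_eq d hz.1]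
  abel

/-- The boundary of a chain with exactly one entry equal to one vanishes in the coinvariants. -/
theorem b_mem_tSpan_of_weight_eq {n : ℕ} {y : Chain ℚ (TruncPoly ℚ d) (n + 1)}
    (hy : y ∈ weightPart ℚ d (n + 1) (n + 1)) : b ℚ _ n y ∈ tSpan d (n + 1) n := by
  obtain ⟨u, hu, huy⟩ := exists_sub_mem_tSpan d n.succ_pos hy
  have h1 : b ℚ _ n u = 0 := by
    apply toWords_injective
    rw [toWords_b_lead d hu, map_zero, neg_eq_zero]
    -- A word with at most one entry equal to one has no two adjacent ones to merge.
    have key : ∀ l : List (Option (Fin d)), l.length ≤ l.countP Option.isSome + 1 →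
        mergeWord l = 0 := by
      intro l
      induction l with
      | nil => intro _; rfl
      | cons a l ih =>
        intro hl
        match a, l with
        | a, [] => cases a <;> rfl
        | none, none :: l =>
          have := l.countP_le_length (p := Option.isSome)
          simp at hl
          omega
        | none, some x :: l => rw [mergeWord, ih (by simp at hl ⊢; omega), map_zero, neg_zero]
        | some x, c :: l => rw [mergeWord, ih (by simp at hl ⊢; omega), map_zero, neg_zero]
    refine (leadSpan_le fun x l hl => ?_ : _ ≤ LinearMap.ker merge) hu
    rw [LinearMap.mem_ker, merge_single]
    exact key _ (by rw [hl.1, hl.2])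
  have h2 := b_mem_tSpan d huy
  rwa [map_sub, h1, sub_zero] at h2

end Connes

/-! ### Recognizing the homology of the weight complex. -/

section Homology

open CategoryTheory

theorem nonempty_homology_equiv {R : Type*} [Ring R] (S : ShortComplex (ModuleCat R))
    {M : Type*} [AddCommGroup M] [Module R M] (φ : S.X₂ →ₗ[R] M)
    (h1 : ∀ x, φ (S.f.hom x) = 0) (h2 : ∀ x, S.g.hom x = 0 → φ x = 0 → ∃ y, S.f.hom y = x)
    (h3 : ∀ m, ∃ x, S.g.hom x = 0 ∧ φ x = m) : Nonempty (S.homology ≃ₗ[R] M) := by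
  let ψ : LinearMap.ker S.g.hom →ₗ[R] M := φ.domRestrict _
  have hr : LinearMap.range S.moduleCatToCycles = LinearMap.ker ψ := by
    ext ⟨x, hx⟩
    constructor
    · rintro ⟨y, hy⟩
      rw [← hy]
      exact h1 y
    · intro h
      obtain ⟨y, hy⟩ := h2 x hx h
      exact ⟨y, Subtype.ext hy⟩
  have hs : Function.Surjective ψ := fun m => by
    obtain ⟨x, hx, rfl⟩ := h3 m
    exact ⟨⟨x, hx⟩, rfl⟩
  exact ⟨S.moduleCatHomologyIso.toLinearEquiv ≪≫ₗ Submodule.quotEquivOfEq _ _ hr ≪≫ₗ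
    ψ.quotKerEquivOfSurjective hs⟩

variable (d : ℕ)

/-- The elements of the total complex whose total differential vanishes, componentwise. -/
def IsCycle {n : ℕ} (f : Tot ℚ (TruncPoly ℚ d) n) : Prop :=
  ∀ (p q : ℕ) (h : p + q + 1 = n),
    horiz ℚ _ p q (f ⟨(p + 1, q), by dsimp only; omega⟩) +
      (-1 : ℚ) ^ p • vert ℚ _ p q (f ⟨(p, q + 1), by dsimp only; omega⟩) = 0

theorem isCycle_iff {n : ℕ} (f : Tot ℚ (TruncPoly ℚ d) (n + 1)) :
    IsCycle d f ↔ totD ℚ _ n f = 0 := by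
  constructor
  · intro h
    funext ⟨⟨p, q⟩, hpq⟩
    exact h p q (by dsimp only at hpq; omega)
  · intro h p q hpq
    exact congrFun h ⟨(p, q), by dsimp only; omega⟩

theorem isCycle_totD {n : ℕ} (g : Tot ℚ (TruncPoly ℚ d) (n + 1)) : IsCycle d (totD ℚ _ n g) := by
  cases n with
  | zero => intro p q h; omega
  | succ n =>
    rw [isCycle_iff]
    exact LinearMap.congr_fun (totD_comp_totD ℚ _ n) g

/-- To identify the homology with `M` it suffices to have a map on all chains that kills boundaries,
is onto from cycles, and has only boundaries among the cycles in its kernel. `IsCycle` is vacuous in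
degree 0, so no case distinction is left to the user. -/
theorem nonempty_HC_equiv {w n : ℕ} {M : Type*} [AddCommGroup M] [Module ℚ M]
    (φ : Tot ℚ (TruncPoly ℚ d) n →ₗ[ℚ] M)
    (h1 : ∀ g ∈ totWeight ℚ d w (n + 1), φ (totD ℚ _ n g) = 0)
    (h2 : ∀ f ∈ totWeight ℚ d w n, IsCycle d f → φ f = 0 →
      ∃ g ∈ totWeight ℚ d w (n + 1), totD ℚ _ n g = f)
    (h3 : ∀ m, ∃ f ∈ totWeight ℚ d w n, IsCycle d f ∧ φ f = m) :
    Nonempty (HC ℚ d w n ≃ₗ[ℚ] M) := by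
  let K := weightComplex ℚ d w
  have hd : ∀ j, K.d (j + 1) j =
      ModuleCat.ofHom ((totD ℚ (TruncPoly ℚ d) j).restrict (totD_mem ℚ d w j)) :=
    fun j => ChainComplex.of_d (fun n => ModuleCat.of ℚ (totWeight ℚ d w n))
      (fun n => ModuleCat.ofHom ((totD ℚ (TruncPoly ℚ d) n).restrict (totD_mem ℚ d w n))) j
  have hf : ∀ j, j = n + 1 → ∀ f : totWeight ℚ d w n,
      (∃ y, (K.d j n).hom y = f) ↔ ∃ g ∈ totWeight ℚ d w (n + 1), totD ℚ _ n g = f.1 := by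
    rintro j rfl f
    rw [hd]
    constructor
    · rintro ⟨y, rfl⟩
      exact ⟨y.1, y.2, rfl⟩
    · rintro ⟨g, hg, h⟩
      exact ⟨⟨g, hg⟩, Subtype.ext h⟩
  have hp : (ComplexShape.down ℕ).prev n = n + 1 := ChainComplex.prev ℕ n
  have hg : ∀ f : totWeight ℚ d w n,
      (K.d n ((ComplexShape.down ℕ).next n)).hom f = 0 ↔ IsCycle d f.1 := by
    intro f
    cases n with
    | zero =>
      have : K.d 0 ((ComplexShape.down ℕ).next 0) = 0 := K.shape _ _ (by simp)
      rw [this]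
      exact ⟨fun _ p q h => by omega, fun _ => rfl⟩
    | succ n =>
      rw [isCycle_iff, ChainComplex.next_nat_succ, hd]
      exact Subtype.ext_iff
  refine nonempty_homology_equiv (K.sc n) (φ.domRestrict (totWeight ℚ d w n)) ?_ ?_ ?_
  · intro x
    obtain ⟨g, hg, h⟩ := (hf _ hp _).1 ⟨x, rfl⟩
    exact (congrArg φ h.symm).trans (h1 g hg)
  · intro f h h'
    exact (hf _ hp f).2 (h2 f.1 f.2 ((hg f).1 h) h')
  · intro m
    obtain ⟨f, hfm, hc, h⟩ := h3 m
    exact ⟨⟨f, hfm⟩, (hg ⟨f, hfm⟩).2 hc, h⟩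

end Homology

/-! ### Reduction to the coinvariants by a staircase argument. -/

section Staircase

variable (d : ℕ)

/-- The rows of the Tsygan double complex are exact in positive degrees. -/
theorem exists_horiz_eq {w p q : ℕ} {y : Chain ℚ (TruncPoly ℚ d) q}
    (hy : y ∈ weightPart ℚ d w q) (h : horiz ℚ _ p q y = 0) :
    ∃ z ∈ weightPart ℚ d w q, horiz ℚ _ (p + 1) q z = y := by
  have hq : (q + 1 : ℚ) ≠ 0 := by positivity
  by_cases hp : Even p
  · have hp' : ¬ Even (p + 1) := by simpa [Nat.even_add_one] using hp
    rw [horiz, if_pos hp, LinearMap.sub_apply, Module.End.one_apply, sub_eq_zero] at h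
    -- A `t`-invariant chain satisfies `N y = (q + 1) y`.
    refine ⟨(q + 1 : ℚ)⁻¹ • y, Submodule.smul_mem _ _ hy, ?_⟩
    have ht : ∀ i, (t ℚ (TruncPoly ℚ d) q ^ i) y = y := by
      intro i
      induction i with
      | zero => simp
      | succ i ih =>
        rw [pow_succ (t ℚ (TruncPoly ℚ d) q), Module.End.mul_apply]
        exact (congrArg _ h.symm).trans ih
    rw [horiz, if_neg hp', map_smul, N, LinearMap.sum_apply, Finset.sum_congr rfl fun i _ => ht i,
      Finset.sum_const, Finset.card_range, ← Nat.cast_smul_eq_nsmul ℚ, smul_smul, Nat.cast_add,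
      Nat.cast_one, inv_mul_cancel₀ hq, one_smul]
  · have hp' : Even (p + 1) := by simpa [Nat.even_add_one] using hp
    rw [horiz, if_neg hp] at h
    -- Since `(1 - t) ∑_{j<i} t^j = 1 - t^i`, summing over `i ≤ q` gives `(q + 1) - N`, and `N y =
    -- 0`.
    refine ⟨(q + 1 : ℚ)⁻¹ • ∑ i ∈ Finset.range (q + 1), ∑ j ∈ Finset.range i,
      (t ℚ (TruncPoly ℚ d) q ^ j) y, Submodule.smul_mem _ _ (Submodule.sum_mem _ fun i _ =>
        Submodule.sum_mem _ fun j _ => t_pow_mem ℚ d w q j hy), ?_⟩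
    have h1 : ∀ i, (1 - t ℚ (TruncPoly ℚ d) q)
        (∑ j ∈ Finset.range i, (t ℚ (TruncPoly ℚ d) q ^ j) y) =
          y - (t ℚ (TruncPoly ℚ d) q ^ i) y := by
      intro i
      have := LinearMap.congr_fun (mul_neg_geom_sum (t ℚ (TruncPoly ℚ d) q) i) y
      simpa only [Module.End.mul_apply, LinearMap.sum_apply, LinearMap.sub_apply,
        Module.End.one_apply] using this
    rw [N, LinearMap.sum_apply] at h
    rw [horiz, if_pos hp', map_smul, map_sum, Finset.sum_congr rfl fun i _ => h1 i,
      Finset.sum_sub_distrib, h, sub_zero, Finset.sum_const, Finset.card_range,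
      ← Nat.cast_smul_eq_nsmul ℚ, smul_smul, Nat.cast_add, Nat.cast_one, inv_mul_cancel₀ hq,
      one_smul]

theorem single_mem_totWeight {w n : ℕ} (x : {x : ℕ × ℕ // x.1 + x.2 = n})
    {y : Chain ℚ (TruncPoly ℚ d) x.1.2} (hy : y ∈ weightPart ℚ d w x.1.2) :
    (Pi.single x y : Tot ℚ (TruncPoly ℚ d) n) ∈ totWeight ℚ d w n := by
  intro x' _
  by_cases h : x' = x
  · subst h
    rw [Pi.single_eq_same]
    exact hy
  · rw [Pi.single_eq_of_ne h]
    exact Submodule.zero_mem _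

theorem apply_mem {w n : ℕ} {f : Tot ℚ (TruncPoly ℚ d) n} (hf : f ∈ totWeight ℚ d w n) (p q : ℕ)
    (h : p + q = n) : f ⟨(p, q), h⟩ ∈ weightPart ℚ d w q :=
  hf (⟨(p, q), h⟩ : {x : ℕ × ℕ // x.1 + x.2 = n}) trivial

theorem IsCycle.sub {n : ℕ} {f g : Tot ℚ (TruncPoly ℚ d) n} (hf : IsCycle d f)
    (hg : IsCycle d g) : IsCycle d (f - g) := by
  intro p q h
  rw [Pi.sub_apply, Pi.sub_apply, map_sub, map_sub, smul_sub, sub_add_sub_comm, hf p q h,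
    hg p q h, sub_zero]

theorem totD_apply {n : ℕ} (g : Tot ℚ (TruncPoly ℚ d) (n + 1)) (p q : ℕ) (h : p + q = n) :
    totD ℚ _ n g ⟨(p, q), h⟩ = horiz ℚ _ p q (g ⟨(p + 1, q), by dsimp only; omega⟩) +
      (-1 : ℚ) ^ p • vert ℚ _ p q (g ⟨(p, q + 1), by dsimp only; omega⟩) := rfl

/-- A cycle of the total complex whose component in the first column vanishes is a boundary. -/
theorem exists_totD_eq_of_zero {w n : ℕ} {f : Tot ℚ (TruncPoly ℚ d) n}
    (hf : f ∈ totWeight ℚ d w n) (hc : IsCycle d f) (h0 : f ⟨(0, n), by simp⟩ = 0) :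
    ∃ g ∈ totWeight ℚ d w (n + 1), g ⟨(0, n + 1), by simp⟩ = 0 ∧ totD ℚ _ n g = f := by
  -- The primitive is built column by column: `g` is correct in the columns up to `k`.
  have key : ∀ k : ℕ, ∃ g ∈ totWeight ℚ d w (n + 1), g ⟨(0, n + 1), by simp⟩ = 0 ∧
      ∀ (p q : ℕ) (h : p + q = n), p < k + 1 → totD ℚ _ n g ⟨(p, q), h⟩ = f ⟨(p, q), h⟩ := by
    intro k
    induction k with
    | zero =>
      refine ⟨0, Submodule.zero_mem _, rfl, fun p q h hp => ?_⟩
      obtain rfl : p = 0 := by omega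
      obtain rfl : q = n := by omega
      rw [map_zero, h0, Pi.zero_apply]
    | succ k ih =>
      obtain ⟨g, hg, hg0, hgf⟩ := ih
      by_cases hkn : k + 1 ≤ n
      · obtain ⟨q, hq⟩ : ∃ q, k + 1 + q = n := ⟨n - (k + 1), by omega⟩
        -- The error `f - totD g` is a cycle with zero entry in column `k`, so its entry in column
        -- `k + 1` is killed by the horizontal map. Exactness lifts it to column `k + 2`, where a
        -- correction leaves the earlier columns of the boundary unchanged.
        have he := hc.sub d (isCycle_totD d g) k q (by omega)
        rw [Pi.sub_apply, Pi.sub_apply, hgf k (q + 1) (by omega) (by omega), sub_self, map_zero,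
          smul_zero, add_zero] at he
        obtain ⟨z, hz, hze⟩ := exists_horiz_eq d (Submodule.sub_mem _
          (apply_mem d hf (k + 1) q hq) (apply_mem d (totD_mem ℚ d w n g hg) (k + 1) q hq)) he
        let s : Tot ℚ (TruncPoly ℚ d) (n + 1) :=
          Pi.single ⟨(k + 1 + 1, q), by dsimp only; omega⟩ z
        have hs0 : ∀ x : {x : ℕ × ℕ // x.1 + x.2 = n + 1}, x.1 ≠ (k + 1 + 1, q) → s x = 0 :=
          fun x hx => Pi.single_eq_of_ne (fun e => hx (congrArg Subtype.val e)) _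
        refine ⟨g + s, Submodule.add_mem _ hg (single_mem_totWeight d _ hz), ?_, ?_⟩
        · rw [Pi.add_apply, hg0, hs0 _ (by simp), add_zero]
        · intro p q' h hp
          have hv : s ⟨(p, q' + 1), by dsimp only; omega⟩ = 0 :=
            hs0 _ (by simp only [ne_eq, Prod.mk.injEq]; omega)
          rw [map_add, Pi.add_apply, totD_apply d s, hv, map_zero, smul_zero, add_zero]
          rcases Nat.lt_or_ge p (k + 1) with hpk | hpk
          · have hh : s ⟨(p + 1, q'), by dsimp only; omega⟩ = 0 :=
              hs0 _ (by simp only [ne_eq, Prod.mk.injEq]; omega)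
            rw [hh, map_zero, add_zero, hgf p q' h hpk]
          · obtain rfl : p = k + 1 := by omega
            obtain rfl : q' = q := by omega
            have hh : s ⟨(k + 1 + 1, q'), by dsimp only; omega⟩ = z := Pi.single_eq_same _ _
            rw [hh, hze]
            exact add_sub_cancel _ _
      · exact ⟨g, hg, hg0, fun p q h hp => hgf p q h (by omega)⟩
  obtain ⟨g, hg, hg0, hgf⟩ := key n
  refine ⟨g, hg, hg0, funext fun ⟨⟨p, q⟩, h⟩ => hgf p q h ?_⟩
  dsimp only at h
  omega

/-- The element of the total complex with entries `y` and `z` in the first two columns. -/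
noncomputable def firstColumns (n : ℕ) (y : Chain ℚ (TruncPoly ℚ d) (n + 1))
    (z : Chain ℚ (TruncPoly ℚ d) n) : Tot ℚ (TruncPoly ℚ d) (n + 1) :=
  Pi.single ⟨(0, n + 1), by simp⟩ y + Pi.single ⟨(1, n), by dsimp only; omega⟩ z

theorem firstColumns_zero (n : ℕ) (y : Chain ℚ (TruncPoly ℚ d) (n + 1))
    (z : Chain ℚ (TruncPoly ℚ d) n) : firstColumns d n y z ⟨(0, n + 1), by simp⟩ = y := by
  rw [firstColumns, Pi.add_apply, Pi.single_eq_same, Pi.single_eq_of_ne (by simp), add_zero]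

theorem firstColumns_one (n : ℕ) (y : Chain ℚ (TruncPoly ℚ d) (n + 1))
    (z : Chain ℚ (TruncPoly ℚ d) n) :
    firstColumns d n y z ⟨(1, n), by dsimp only; omega⟩ = z := by
  rw [firstColumns, Pi.add_apply, Pi.single_eq_same, Pi.single_eq_of_ne (by simp), zero_add]

theorem firstColumns_mem {w n : ℕ} {y : Chain ℚ (TruncPoly ℚ d) (n + 1)}
    {z : Chain ℚ (TruncPoly ℚ d) n} (hy : y ∈ weightPart ℚ d w (n + 1))
    (hz : z ∈ weightPart ℚ d w n) : firstColumns d n y z ∈ totWeight ℚ d w (n + 1) :=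
  Submodule.add_mem _ (single_mem_totWeight d _ hy) (single_mem_totWeight d _ hz)

theorem totD_zero_column {n : ℕ} (g : Tot ℚ (TruncPoly ℚ d) (n + 1)) :
    totD ℚ _ n g ⟨(0, n), by simp⟩ =
      (1 - t ℚ (TruncPoly ℚ d) n) (g ⟨(1, n), by dsimp only; omega⟩) +
        b ℚ _ n (g ⟨(0, n + 1), by simp⟩) := by
  rw [totD_apply]
  simp [horiz, vert]

/-- The cycles, of weight `w`, of the complex of coinvariants of the cyclic operator. -/
def IsConnesCycle (w : ℕ) : ∀ {n : ℕ}, Chain ℚ (TruncPoly ℚ d) n → Prop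
  | 0, _ => True
  | n + 1, y => b ℚ _ n y ∈ tSpan d w n

/-- The weight `w` part of the cyclic homology can be computed from the complex of coinvariants of
the cyclic operator. -/
theorem nonempty_HC_equiv_of_coinvariants {w n : ℕ} {M : Type*} [AddCommGroup M] [Module ℚ M]
    (φ : Chain ℚ (TruncPoly ℚ d) n →ₗ[ℚ] M)
    (h1 : ∀ y ∈ tSpan d w n, φ y = 0)
    (h2 : ∀ y ∈ weightPart ℚ d w (n + 1), φ (b ℚ _ n y) = 0)
    (h3 : ∀ y ∈ weightPart ℚ d w n, IsConnesCycle d w y → φ y = 0 →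
      ∃ z ∈ weightPart ℚ d w (n + 1), y - b ℚ _ n z ∈ tSpan d w n)
    (h4 : ∀ m, ∃ y ∈ weightPart ℚ d w n, IsConnesCycle d w y ∧ φ y = m) :
    Nonempty (HC ℚ d w n ≃ₗ[ℚ] M) := by
  refine nonempty_HC_equiv d
    (φ ∘ₗ LinearMap.proj (⟨(0, n), by simp⟩ : {x : ℕ × ℕ // x.1 + x.2 = n})) ?_ ?_ ?_
  · intro g hg
    have e1 := h1 _ (Submodule.mem_map_of_mem (apply_mem d hg 1 n (by omega)))
    have e2 := h2 _ (apply_mem d hg 0 (n + 1) (by omega))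
    rw [LinearMap.comp_apply, LinearMap.proj_apply, totD_zero_column, map_add, e1, e2, add_zero]
  · intro f hf hc hφ
    have hcc : IsConnesCycle d w (f ⟨(0, n), by simp⟩) := by
      cases n with
      | zero => trivial
      | succ n =>
        have h := totD_zero_column d f
        rw [(isCycle_iff d f).1 hc] at h
        refine ⟨-f ⟨(1, n), by dsimp only; omega⟩, Submodule.neg_mem _ (apply_mem d hf 1 n _), ?_⟩
        rw [map_neg]
        exact neg_eq_of_add_eq_zero_right h.symm
    -- The relation `f₀ - b z = (1 - t) u` says that the boundary of the element with columns `z, u`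
    -- agrees with `f` in column 0; the staircase takes care of the difference.
    obtain ⟨z, hz, u, hu, hzu⟩ := h3 _ (apply_mem d hf 0 n _) hcc hφ
    have hs := firstColumns_mem d hz hu
    obtain ⟨g, hg, -, hgf⟩ := exists_totD_eq_of_zero d
      (Submodule.sub_mem _ hf (totD_mem ℚ d w n _ hs))
      (hc.sub d (isCycle_totD d (firstColumns d n z u))) (by
        rw [Pi.sub_apply, totD_zero_column, firstColumns_zero, firstColumns_one, hzu]
        abel)
    exact ⟨g + firstColumns d n z u, Submodule.add_mem _ hg hs, by rw [map_add, hgf]; abel⟩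
  · intro m
    obtain ⟨y, hy, hcc, rfl⟩ := h4 m
    cases n with
    | zero =>
      refine ⟨Pi.single ⟨(0, 0), by simp⟩ y, single_mem_totWeight d _ hy, ?_, ?_⟩
      · intro p q h
        omega
      · rw [LinearMap.comp_apply, LinearMap.proj_apply, Pi.single_eq_same]
    | succ n =>
      -- From `b y = (1 - t) u`, the boundary of the element with columns `y, -u` vanishes in column
      -- 0. It is then also the boundary of some `g` without column 0, and subtracting `g` completes
      -- `y` to a cycle.
      obtain ⟨u, hu, hub⟩ := hcc
      have hs := firstColumns_mem d hy (Submodule.neg_mem _ hu)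
      obtain ⟨g, hg, hg0, hgf⟩ := exists_totD_eq_of_zero d (totD_mem ℚ d w n _ hs)
        (isCycle_totD d _) (by
          rw [totD_zero_column, firstColumns_zero, firstColumns_one, map_neg, hub,
            neg_add_cancel])
      refine ⟨firstColumns d n y (-u) - g, Submodule.sub_mem _ hs hg, ?_, ?_⟩
      · rw [isCycle_iff, map_sub, hgf, sub_self]
      · rw [LinearMap.comp_apply, LinearMap.proj_apply, Pi.sub_apply, hg0, firstColumns_zero,
          sub_zero]

theorem subsingleton_HC {w n : ℕ}
    (h : ∀ y ∈ weightPart ℚ d w n, IsConnesCycle d w y →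
      ∃ z ∈ weightPart ℚ d w (n + 1), y - b ℚ _ n z ∈ tSpan d w n) :
    Subsingleton (HC ℚ d w n) := by
  obtain ⟨e⟩ := nonempty_HC_equiv_of_coinvariants d (w := w) (n := n)
    (0 : _ →ₗ[ℚ] PUnit.{1}) (fun _ _ => rfl) (fun _ _ => rfl) (fun y hy hc _ => h y hy hc)
    (fun m => ⟨0, Submodule.zero_mem _, by
      cases n
      · trivial
      · simp [IsConnesCycle], rfl⟩)
  exact e.toEquiv.subsingleton

end Staircase

/-! ### Cycle families, periodic words, and the count of `ω_{m,d}`. -/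

section CyclicWords

open Function

variable {d : ℕ}

theorem rotWord_iterate (m r : ℕ) (v : Fin m → Fin d) :
    (rotWord m d)^[r] v = fun j => v (((finRotate m).symm ^ r) j) := by
  induction r with
  | zero => rfl
  | succ r ih =>
    rw [iterate_succ_apply', ih]
    funext j
    rw [rotWord, pow_succ, Equiv.Perm.mul_apply]

theorem rotWord_iterate_apply (n r j : ℕ) (hr : r ≤ n + 1) (hj : j < n + 1)
    (v : Fin (n + 1) → Fin d) : (rotWord (n + 1) d)^[r] v ⟨j, hj⟩ =
      v ⟨if r ≤ j then j - r else j + (n + 1) - r, by split_ifs <;> omega⟩ := by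
  rw [rotWord_iterate]
  exact congrArg v (finRotate_symm_pow n r j hr hj)

theorem rotWord_iterate_self (m : ℕ) (v : Fin m → Fin d) : (rotWord m d)^[m] v = v := by
  cases m with
  | zero => rfl
  | succ n =>
    funext ⟨j, hj⟩
    rw [rotWord_iterate_apply n (n + 1) j le_rfl hj]
    exact congrArg v (Fin.ext (by dsimp only; split_ifs <;> omega))

theorem minimalPeriod_pos {m : ℕ} (hm : 0 < m) (v : Fin m → Fin d) :
    0 < minimalPeriod (rotWord m d) v :=
  IsPeriodicPt.minimalPeriod_pos hm (rotWord_iterate_self m v)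

theorem cycleLength_eq {m : ℕ} (hm : 0 < m) (v : Fin m → Fin d) :
    cycleLength v = minimalPeriod (rotWord m d) v := by
  refine le_antisymm (Nat.sInf_le ⟨minimalPeriod_pos hm v, iterate_minimalPeriod⟩) ?_
  have h : cycleLength v ∈ {r | 0 < r ∧ (rotWord m d)^[r] v = v} :=
    Nat.sInf_mem ⟨m, hm, rotWord_iterate_self m v⟩
  exact IsPeriodicPt.minimalPeriod_le h.1 h.2

theorem iterate_eq_iterate_iff {m : ℕ} (hm : 0 < m) (v : Fin m → Fin d) (i j : ℕ) :
    (rotWord m d)^[i] v = (rotWord m d)^[j] v ↔ i ≡ j [MOD minimalPeriod (rotWord m d) v] := by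
  rw [← iterate_mod_minimalPeriod_eq (n := i), ← iterate_mod_minimalPeriod_eq (n := j),
    iterate_eq_iterate_iff_of_lt_minimalPeriod (Nat.mod_lt _ (minimalPeriod_pos hm v))
      (Nat.mod_lt _ (minimalPeriod_pos hm v))]
  rfl

theorem cycleFamily_iterate {m : ℕ} (v : Fin m → Fin d) (j : ℕ) :
    cycleFamily ((rotWord m d)^[j] v) = cycleFamily v := by
  ext u
  constructor
  · rintro ⟨r, rfl⟩
    exact ⟨r + j, (iterate_add_apply _ _ _ _).symm⟩
  · rintro ⟨r, rfl⟩
    -- Rotation by `m * j` is the identity, so `m * j - j` more rotations undo the first `j`.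
    refine ⟨r + (m * j - j), ?_⟩
    rw [← iterate_add_apply]
    rcases Nat.eq_zero_or_pos m with rfl | hm
    · exact Subsingleton.elim _ _
    · have h : j ≤ m * j := Nat.le_mul_of_pos_left j hm
      rw [show r + (m * j - j) + j = r + m * j by omega, iterate_add_apply,
        (IsPeriodicPt.mul_const (rotWord_iterate_self m v) j : _)]

/-- The periodic extension of a word of length `m` to a word of length `w`. -/
def extendWord {m : ℕ} (hm : 0 < m) (w : ℕ) (u : Fin m → Fin d) : Fin w → Fin d :=
  fun i => u ⟨i % m, Nat.mod_lt _ hm⟩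

theorem extendWord_injective {m w : ℕ} (hm : 0 < m) (hmw : m ≤ w) :
    Injective (extendWord (d := d) hm w) := by
  intro u v h
  funext ⟨i, hi⟩
  simpa [extendWord, Nat.mod_eq_of_lt hi] using congrFun h ⟨i, by omega⟩

/-- Only the wrap-around uses divisibility: the last position `w - 1` has residue `m - 1` because `m
∣ w`. -/
theorem rotWord_extendWord {m w : ℕ} (hm : 0 < m) (hmw : m ∣ w) (u : Fin m → Fin d) :
    rotWord w d (extendWord hm w u) = extendWord hm w (rotWord m d u) := by
  obtain ⟨m, rfl⟩ : ∃ m', m = m' + 1 := ⟨m - 1, by omega⟩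
  funext ⟨i, hi⟩
  obtain ⟨n, rfl⟩ : ∃ n, w = n + 1 := ⟨w - 1, by omega⟩
  simp only [rotWord, extendWord, finRotate_symm_mk]
  refine congrArg u (Fin.ext ?_)
  dsimp only
  rcases Nat.eq_zero_or_pos i with rfl | h0
  · obtain ⟨k, hk⟩ := hmw
    obtain ⟨k, rfl⟩ : ∃ k', k = k' + 1 := ⟨k - 1, by cases k <;> simp_all⟩
    rw [if_pos rfl, Nat.zero_mod, if_pos rfl,
      show n = (m + 1) * k + m by rw [Nat.mul_succ] at hk; omega,
      Nat.mul_add_mod, Nat.mod_eq_of_lt (by omega)]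
  · have hdiv := Nat.div_add_mod i (m + 1)
    have hlt : i % (m + 1) < m + 1 := Nat.mod_lt i hm
    rw [if_neg h0.ne']
    split_ifs with h1
    · obtain ⟨q, hq⟩ : ∃ q, i / (m + 1) = q + 1 := ⟨i / (m + 1) - 1, by
        rcases Nat.eq_zero_or_pos (i / (m + 1)) with h | h
        · rw [h] at hdiv; omega
        · omega⟩
      rw [hq, Nat.mul_succ] at hdiv
      rw [show i - 1 = (m + 1) * q + m by omega, Nat.mul_add_mod, Nat.mod_eq_of_lt (by omega)]
    · rw [show i - 1 = (m + 1) * (i / (m + 1)) + (i % (m + 1) - 1) by omega,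
        Nat.mul_add_mod, Nat.mod_eq_of_lt (by omega)]

theorem iterate_extendWord {m w : ℕ} (hm : 0 < m) (hmw : m ∣ w) (u : Fin m → Fin d) (j : ℕ) :
    (rotWord w d)^[j] (extendWord hm w u) = extendWord hm w ((rotWord m d)^[j] u) := by
  induction j with
  | zero => rfl
  | succ j ih => rw [iterate_succ_apply', iterate_succ_apply', ih, rotWord_extendWord hm hmw]

theorem minimalPeriod_extendWord {m w : ℕ} (hm : 0 < m) (hw : 0 < w) (hmw : m ∣ w)
    (u : Fin m → Fin d) :
    minimalPeriod (rotWord w d) (extendWord hm w u) = minimalPeriod (rotWord m d) u := by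
  rw [minimalPeriod_eq_minimalPeriod_iff]
  intro n
  rw [IsPeriodicPt, IsFixedPt, iterate_extendWord hm hmw,
    (extendWord_injective hm (Nat.le_of_dvd hw hmw)).eq_iff]
  rfl

/-- Take `m` to be the minimal period of `v` and `u` its first `m` letters. Extension preserves
minimal periods, so `u` has full cycle length. -/
theorem exists_extendWord_eq {w : ℕ} (hw : 0 < w) (v : Fin w → Fin d) :
    ∃ (m : ℕ) (hm : 0 < m) (u : Fin m → Fin d), m ∣ w ∧ cycleLength u = m ∧
      extendWord hm w u = v := by
  have hm := minimalPeriod_pos hw v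
  have hmw : minimalPeriod (rotWord w d) v ∣ w :=
    IsPeriodicPt.minimalPeriod_dvd (rotWord_iterate_self w v)
  have hle := Nat.le_of_dvd hw hmw
  set m := minimalPeriod (rotWord w d) v with hmdef
  have hv : ∀ (i : ℕ) (hi : i < w), v ⟨i, hi⟩ = v ⟨i % m, (Nat.mod_le _ _).trans_lt hi⟩ := by
    intro i
    induction i using Nat.strong_induction_on with
    | _ i ih =>
      intro hi
      rcases Nat.lt_or_ge i m with h | h
      · congr 2
        exact (Nat.mod_eq_of_lt h).symm
      · obtain ⟨n, rfl⟩ : ∃ n, w = n + 1 := ⟨w - 1, by omega⟩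
        have h1 : (rotWord (n + 1) d)^[m] v = v := iterate_minimalPeriod
        have h2 := congrFun h1 ⟨i, hi⟩
        rw [rotWord_iterate_apply n m i hle hi] at h2
        simp only [h, if_true] at h2
        rw [← h2, ih (i - m) (by omega)]
        congr 2
        exact (Nat.mod_eq_sub_mod h).symm
  have hext : extendWord hm w (fun i : Fin m => v ⟨i, by omega⟩) = v :=
    funext fun ⟨i, hi⟩ => (hv i hi).symm
  refine ⟨m, hm, fun i => v ⟨i, by omega⟩, hmw, ?_, hext⟩
  rw [cycleLength_eq hm, ← minimalPeriod_extendWord hm hw hmw, hext]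

/-- A word in a given cycle family. -/
noncomputable def familyRep {m : ℕ} (S : omega m d) : Fin m → Fin d := S.2.choose

theorem cycleLength_familyRep {m : ℕ} (S : omega m d) : cycleLength (familyRep S) = m :=
  S.2.choose_spec.1

theorem cycleFamily_familyRep {m : ℕ} (S : omega m d) : cycleFamily (familyRep S) = S.1 :=
  S.2.choose_spec.2.symm

/-- Every word is a rotation of the periodic extension of the chosen element of a cycle family. -/
theorem exists_iterate_familyRep {w : ℕ} (hw : 0 < w) (v : Fin w → Fin d) :
    ∃ (m : ℕ) (hm : 0 < m) (S : omega m d) (j : ℕ), m ∣ w ∧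
      (rotWord w d)^[j] (extendWord hm w (familyRep S)) = v := by
  obtain ⟨m, hm, u, hmw, hu, rfl⟩ := exists_extendWord_eq hw v
  let S : omega m d := ⟨cycleFamily u, u, hu, rfl⟩
  have h1 : u ∈ cycleFamily (familyRep S) := by
    rw [cycleFamily_familyRep]
    exact ⟨0, rfl⟩
  obtain ⟨j, hj⟩ := h1
  exact ⟨m, hm, S, j, hmw, by rw [iterate_extendWord hm hmw, ← hj]⟩

theorem length_eq_of_iterate_eq {w m m' : ℕ} (hw : 0 < w) (hm : 0 < m) (hm' : 0 < m')
    (hmw : m ∣ w) (hmw' : m' ∣ w) (S : omega m d) (S' : omega m' d) (j j' : ℕ)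
    (h : (rotWord w d)^[j] (extendWord hm w (familyRep S)) =
      (rotWord w d)^[j'] (extendWord hm' w (familyRep S'))) : m = m' := by
  have key : ∀ (m : ℕ) (hm : 0 < m), m ∣ w → ∀ (S : omega m d) (j : ℕ),
      minimalPeriod (rotWord w d) ((rotWord w d)^[j] (extendWord hm w (familyRep S))) = m := by
    intro m hm hmw S j
    rw [iterate_extendWord hm hmw, minimalPeriod_extendWord hm hw hmw,
      minimalPeriod_apply_iterate (mk_mem_periodicPts hm (rotWord_iterate_self m _)),
      ← cycleLength_eq hm, cycleLength_familyRep]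
  rw [← key m hm hmw S j, h, key m' hm' hmw' S' j']

theorem family_eq_of_iterate_eq {w m : ℕ} (hw : 0 < w) (hm : 0 < m) (hmw : m ∣ w)
    (S S' : omega m d) (j j' : ℕ)
    (h : (rotWord w d)^[j] (extendWord hm w (familyRep S)) =
      (rotWord w d)^[j'] (extendWord hm w (familyRep S'))) : S = S' ∧ j ≡ j' [MOD m] := by
  rw [iterate_extendWord hm hmw, iterate_extendWord hm hmw] at h
  have h1 := extendWord_injective hm (Nat.le_of_dvd hw hmw) h
  have hS : S = S' := by
    apply Subtype.ext
    rw [← cycleFamily_familyRep, ← cycleFamily_familyRep, ← cycleFamily_iterate _ j, h1,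
      cycleFamily_iterate]
  subst hS
  rw [iterate_eq_iterate_iff hm, ← cycleLength_eq hm, cycleLength_familyRep] at h1
  exact ⟨rfl, h1⟩

/-- Every word of length `w` arises from exactly one triple of a divisor `m`, a family in `ω_{m,d}`
and a rotation index modulo `m`: the minimal period recovers `m`, and the cycle family of the
primitive word recovers the rest. -/
theorem sum_mul_ncard_omega {w : ℕ} (hw : 0 < w) :
    ∑ m ∈ w.divisors, m * (omega m d).ncard = d ^ w := by
  classical
  have hpos : ∀ m : w.divisors, 0 < m.1 := fun m => Nat.pos_of_mem_divisors m.2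
  let F : (Σ m : w.divisors, omega m.1 d × Fin m.1) → (Fin w → Fin d) := fun x =>
    (rotWord w d)^[x.2.2] (extendWord (hpos x.1) w (familyRep x.2.1))
  have hF : Bijective F := by
    constructor
    · rintro ⟨⟨m, hm⟩, S, j⟩ ⟨⟨m', hm'⟩, S', j'⟩ h
      obtain rfl := length_eq_of_iterate_eq hw (hpos ⟨m, hm⟩) (hpos ⟨m', hm'⟩)
        (Nat.dvd_of_mem_divisors hm) (Nat.dvd_of_mem_divisors hm') S S' j j' h
      obtain ⟨rfl, hj⟩ := family_eq_of_iterate_eq hw (hpos ⟨m, hm⟩)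
        (Nat.dvd_of_mem_divisors hm) S S' j j' h
      obtain rfl : j = j' := Fin.ext (Nat.ModEq.eq_of_lt_of_lt hj j.2 j'.2)
      rfl
    · intro v
      obtain ⟨m, hm, S, j, hmw, rfl⟩ := exists_iterate_familyRep hw v
      refine ⟨⟨⟨m, Nat.mem_divisors.2 ⟨hmw, hw.ne'⟩⟩, S, ⟨j % m, Nat.mod_lt _ hm⟩⟩, ?_⟩
      change (rotWord w d)^[j % m] _ = _
      rw [iterate_eq_iterate_iff hw, minimalPeriod_extendWord hm hw hmw, ← cycleLength_eq hm,
        cycleLength_familyRep]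
      exact Nat.mod_modEq j m
  have h := Nat.card_eq_of_bijective F hF
  rw [Nat.card_sigma, Nat.card_fun, Nat.card_fin, Nat.card_fin] at h
  rw [← h, ← Finset.sum_coe_sort]
  refine Finset.sum_congr rfl fun m _ => ?_
  rw [Nat.card_prod, Nat.card_fin, Nat.card_coe_set_eq, mul_comm]

theorem ncard_omega {m : ℕ} (hm : 0 < m) : ((omega m d).ncard : ℚ) =
    (∑ i ∈ m.divisors, (ArithmeticFunction.moebius (m / i) : ℚ) * (d : ℚ) ^ i) / m := by
  have h := (ArithmeticFunction.sum_eq_iff_sum_mul_moebius_eq (R := ℚ)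
    (f := fun m => m * ((omega m d).ncard : ℚ)) (g := fun m => (d : ℚ) ^ m)).1
    (fun n hn => by exact_mod_cast sum_mul_ncard_omega (d := d) hn) m hm
  rw [Nat.sum_divisorsAntidiagonal' (fun i j => (ArithmeticFunction.moebius i : ℚ) * (d : ℚ) ^ j)]
    at h
  rw [h, mul_div_cancel_left₀ _ (by positivity)]

end CyclicWords

/-! ### Weight zero. -/

section WeightZero

variable (d : ℕ)

/-- The tensor monomial all of whose entries are one. -/
noncomputable abbrev oneChain (n : ℕ) : Chain ℚ (TruncPoly ℚ d) n := tmono d fun _ => none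

theorem oneChain_mem (n : ℕ) : oneChain d n ∈ weightPart ℚ d 0 n :=
  Submodule.subset_span ⟨_, by simp, rfl⟩

theorem eq_smul_oneChain {n : ℕ} {y : Chain ℚ (TruncPoly ℚ d) n}
    (hy : y ∈ weightPart ℚ d 0 n) : ∃ c : ℚ, y = c • oneChain d n := by
  have h : weightPart ℚ d 0 n ≤ Submodule.span ℚ {oneChain d n} := by
    rw [weightPart, Submodule.span_le]
    rintro _ ⟨v, hv, rfl⟩
    have : v = fun _ => none := by
      funext j
      rw [Finset.card_eq_zero, Finset.filter_eq_empty_iff] at hv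
      simpa using hv (Finset.mem_univ j)
    rw [this]
    exact Submodule.mem_span_singleton_self _
  obtain ⟨c, rfl⟩ := Submodule.mem_span_singleton.1 (h hy)
  exact ⟨c, rfl⟩

theorem t_oneChain (n : ℕ) : t ℚ (TruncPoly ℚ d) n (oneChain d n) = (-1 : ℚ) ^ n • oneChain d n := by
  rw [t, LinearMap.smul_apply, rot_tprod]

theorem b_oneChain {n : ℕ} (hn : Even n) : b ℚ _ n (oneChain d (n + 1)) = 0 := by
  have h : ∀ i, face ℚ _ n i (oneChain d (n + 1)) = oneChain d n := by
    intro i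
    rw [face_tprod]
    congr 1
    funext ⟨j, hj⟩
    obtain ⟨i, hi⟩ := i
    rw [faceFun_mk]
    simp [mono]
  rw [b, LinearMap.sum_apply]
  -- All `n + 2` faces coincide, so their alternating sum vanishes for even `n`.
  simp only [LinearMap.smul_apply, h]
  rw [← Finset.sum_smul, Finset.sum_range (fun i => (-1 : ℚ) ^ i) |>.symm, neg_one_geom_sum,
    if_pos (by simpa [Nat.even_add] using hn), zero_smul]

theorem mem_tSpan_zero_of_odd {n : ℕ} (hn : ¬ Even n) {y : Chain ℚ (TruncPoly ℚ d) n}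
    (hy : y ∈ weightPart ℚ d 0 n) : y ∈ tSpan d 0 n := by
  obtain ⟨c, rfl⟩ := eq_smul_oneChain d hy
  refine ⟨(c / 2) • oneChain d n, Submodule.smul_mem _ _ (oneChain_mem d n), ?_⟩
  rw [map_smul, LinearMap.sub_apply, Module.End.one_apply, t_oneChain,
    (Nat.not_even_iff_odd.1 hn).neg_one_pow, neg_one_smul, sub_neg_eq_add, ← two_smul ℚ, smul_smul]
  congr 1
  ring

theorem subsingleton_HC_zero {n : ℕ} (hn : ¬ Even n) : Subsingleton (HC ℚ d 0 n) :=
  subsingleton_HC d fun y hy _ => ⟨0, Submodule.zero_mem _, by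
    rw [map_zero, sub_zero]
    exact mem_tSpan_zero_of_odd d hn hy⟩

theorem nonempty_HC_zero_equiv {n : ℕ} (hn : Even n) : Nonempty (HC ℚ d 0 n ≃ₗ[ℚ] ℚ) := by
  have hφ : (chainBasis d n).coord (fun _ => none) (oneChain d n) = 1 := by
    rw [oneChain, ← chainBasis_apply d n fun _ => none, Module.Basis.coord_apply,
      Module.Basis.repr_self, Finsupp.single_eq_same]
  refine nonempty_HC_equiv_of_coinvariants d ((chainBasis d n).coord fun _ => none) ?_ ?_ ?_ ?_
  · rintro _ ⟨u, hu, rfl⟩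
    obtain ⟨c, rfl⟩ := eq_smul_oneChain d hu
    rw [map_smul, LinearMap.sub_apply, Module.End.one_apply, t_oneChain, hn.neg_one_pow, one_smul,
      sub_self, smul_zero, map_zero]
  · intro y hy
    obtain ⟨c, rfl⟩ := eq_smul_oneChain d hy
    rw [map_smul, b_oneChain d hn, smul_zero, map_zero]
  · intro y hy _ h
    obtain ⟨c, rfl⟩ := eq_smul_oneChain d hy
    rw [map_smul, hφ, smul_eq_mul, mul_one] at h
    refine ⟨0, Submodule.zero_mem _, ?_⟩
    rw [h, zero_smul, map_zero, sub_zero]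
    exact Submodule.zero_mem _
  · intro c
    refine ⟨c • oneChain d n, Submodule.smul_mem _ _ (oneChain_mem d n), ?_, ?_⟩
    · cases n with
      | zero => trivial
      | succ n =>
        exact mem_tSpan_zero_of_odd d (by simpa [Nat.even_add_one] using hn)
          (b_mem d (Submodule.smul_mem _ _ (oneChain_mem d _)))
    · rw [map_smul, hφ, smul_eq_mul, mul_one]

end WeightZero

/-! ### Positive weight: signed orbits of words without ones. -/

section PositiveWeight

variable (d : ℕ)

theorem weightPart_eq_bot {w n : ℕ} (h : n + 1 < w) : weightPart ℚ d w n = ⊥ := by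
  rw [eq_bot_iff]
  refine weightPart_le d fun v hv => absurd hv.2 ?_
  have := (List.ofFn v).countP_le_length (p := Option.isSome)
  rw [List.length_ofFn] at this
  omega

theorem subsingleton_HC_of_ne {w n : ℕ} (hw : 0 < w) (hn : n + 1 ≠ w) :
    Subsingleton (HC ℚ d w n) := by
  refine subsingleton_HC d fun y hy hc => ?_
  rcases Nat.lt_or_gt_of_ne hn with h | h
  · rw [weightPart_eq_bot d h, Submodule.mem_bot] at hy
    exact ⟨0, Submodule.zero_mem _, by rw [hy, map_zero, sub_zero]; exact Submodule.zero_mem _⟩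
  · obtain ⟨n, rfl⟩ : ∃ m, n = m + 1 := ⟨n - 1, by omega⟩
    exact exists_b_add_of_N_b_eq_zero d hw (by omega) hy (N_eq_zero_of_mem_tSpan d hc)

/-- The tensor monomial of a word without ones. -/
noncomputable abbrev letterChain {n : ℕ} (v : Fin (n + 1) → Fin d) :
    Chain ℚ (TruncPoly ℚ d) n := tmono d fun j => some (v j)

theorem letterChain_mem {n : ℕ} (v : Fin (n + 1) → Fin d) :
    letterChain d v ∈ weightPart ℚ d (n + 1) n :=
  Submodule.subset_span ⟨_, by simp, rfl⟩

theorem weightPart_top_le {n : ℕ} {p : Submodule ℚ (Chain ℚ (TruncPoly ℚ d) n)}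
    (h : ∀ v, letterChain d v ∈ p) : weightPart ℚ d (n + 1) n ≤ p := by
  rw [weightPart, Submodule.span_le]
  rintro _ ⟨v, hv, rfl⟩
  have h1 : ∀ j, (v j).isSome := by
    have h2 : (Finset.univ.filter fun j => (v j).isSome) = Finset.univ :=
      Finset.eq_univ_of_card _ (by rw [hv, Fintype.card_fin])
    intro j
    simpa using Finset.ext_iff.1 h2 j
  have h2 := h fun j => (v j).get (h1 j)
  simp only [letterChain, Option.some_get] at h2
  exact h2

theorem t_letterChain {n : ℕ} (v : Fin (n + 1) → Fin d) :
    t ℚ (TruncPoly ℚ d) n (letterChain d v) =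
      (-1 : ℚ) ^ n • letterChain d (rotWord (n + 1) d v) := by
  rw [t, LinearMap.smul_apply, rot_tprod]
  rfl

theorem letterChain_sub_iterate_mem {n : ℕ} (v : Fin (n + 1) → Fin d) (j : ℕ) :
    letterChain d v - (-1 : ℚ) ^ (n * j) • letterChain d ((rotWord (n + 1) d)^[j] v) ∈
      tSpan d (n + 1) n := by
  induction j with
  | zero => simp
  | succ j ih =>
    have h1 : letterChain d ((rotWord (n + 1) d)^[j] v) - (-1 : ℚ) ^ n •
        letterChain d ((rotWord (n + 1) d)^[j + 1] v) ∈ tSpan d (n + 1) n := by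
      refine ⟨letterChain d ((rotWord (n + 1) d)^[j] v), letterChain_mem d _, ?_⟩
      rw [LinearMap.sub_apply, Module.End.one_apply, t_letterChain, Function.iterate_succ_apply']
    convert Submodule.add_mem _ ih (Submodule.smul_mem _ ((-1 : ℚ) ^ (n * j)) h1) using 1
    rw [smul_sub, smul_smul, ← pow_add, Nat.mul_succ]
    abel

/-- The indices of the summands of the cyclic homology in weight `w`. -/
abbrev HCIndex (d w : ℕ) : Type := Σ m : {m : ℕ // m ∣ w ∧ m ≡ w [MOD 2]}, omega m d

/-- The direct sum of copies of `ℚ` computing the cyclic homology in weight `w`. -/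
abbrev HCSum (d w : ℕ) : Type :=
  ⨁ m : {m : ℕ // m ∣ w ∧ m ≡ w [MOD 2]}, ⨁ _ : omega m d, ℚ

open scoped Classical in
/-- The basis vector of an index. -/
noncomputable def basisVec {w : ℕ} (i : HCIndex d w) : HCSum d w :=
  DirectSum.lof ℚ _ (fun m : {m : ℕ // m ∣ w ∧ m ≡ w [MOD 2]} => ⨁ _ : omega m d, ℚ) i.1
    (DirectSum.lof ℚ _ (fun _ : omega i.1 d => ℚ) i.2 1)

theorem HCIndex.pos {n : ℕ} (i : HCIndex d (n + 1)) : 0 < i.1.1 :=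
  Nat.pos_of_dvd_of_pos i.1.2.1 n.succ_pos

/-- The word of length `n + 1` representing an index. -/
noncomputable def indexWord {n : ℕ} (i : HCIndex d (n + 1)) : Fin (n + 1) → Fin d :=
  extendWord i.pos (n + 1) (familyRep i.2)

open scoped Classical in
/-- The class of a word: a signed basis vector or zero. -/
noncomputable def wordClass {n : ℕ} (v : Fin (n + 1) → Fin d) : HCSum d (n + 1) :=
  if h : ∃ x : HCIndex d (n + 1) × ℕ, (rotWord (n + 1) d)^[x.2] (indexWord d x.1) = v then
    (-1 : ℚ) ^ (n * h.choose.2) • basisVec d h.choose.1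
  else 0

/-- `(-1)^{nm}` is the sign with which `t^m` acts on a word fixed by `m` rotations; its triviality
makes `wordClass` well defined. -/
theorem even_mul_of_modEq {n m : ℕ} (h : m ≡ n + 1 [MOD 2]) : Even (n * m) := by
  rw [Nat.even_mul]
  have : m % 2 = (n + 1) % 2 := h
  rw [Nat.even_iff, Nat.even_iff]
  omega

/-- The choice made in `wordClass` is harmless: the index is determined by the word, the rotation
number is determined modulo `m`, and `n * m` is even. -/
theorem wordClass_iterate {n : ℕ} (i : HCIndex d (n + 1)) (j : ℕ) :
    wordClass d ((rotWord (n + 1) d)^[j] (indexWord d i)) =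
      (-1 : ℚ) ^ (n * j) • basisVec d i := by
  have h : ∃ x : HCIndex d (n + 1) × ℕ, (rotWord (n + 1) d)^[x.2] (indexWord d x.1) =
    (rotWord (n + 1) d)^[j] (indexWord d i) := ⟨(i, j), rfl⟩
  rw [wordClass, dif_pos h]
  have hs := h.choose_spec
  generalize h.choose = x at hs
  obtain ⟨⟨⟨m', hm'⟩, S'⟩, j'⟩ := x
  obtain ⟨⟨m, hm⟩, S⟩ := i
  have hp := HCIndex.pos d ⟨⟨m, hm⟩, S⟩
  have hp' := HCIndex.pos d ⟨⟨m', hm'⟩, S'⟩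
  obtain rfl := length_eq_of_iterate_eq n.succ_pos hp' hp hm'.1 hm.1 S' S j' j hs
  obtain ⟨rfl, hj⟩ := family_eq_of_iterate_eq n.succ_pos hp hm.1 S' S j' j hs
  congr 1
  have he := even_mul_of_modEq hm.2
  dsimp only
  have key : ∀ a, (-1 : ℚ) ^ (n * a) = (-1 : ℚ) ^ (n * (a % m')) := by
    intro a
    conv_lhs => rw [← Nat.div_add_mod a m', mul_add, ← mul_assoc, pow_add, pow_mul,
      he.neg_one_pow, one_pow, one_mul]
  rw [key j', key j, hj]

theorem exists_of_rotWord {n : ℕ} (v : Fin (n + 1) → Fin d) :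
    (∃ x : HCIndex d (n + 1) × ℕ, (rotWord (n + 1) d)^[x.2] (indexWord d x.1) =
      rotWord (n + 1) d v) →
    ∃ x : HCIndex d (n + 1) × ℕ, (rotWord (n + 1) d)^[x.2] (indexWord d x.1) = v := by
  rintro ⟨⟨i, j⟩, h⟩
  refine ⟨(i, n + j), ?_⟩
  rw [Function.iterate_add_apply, h, ← Function.iterate_succ_apply, rotWord_iterate_self]

theorem wordClass_rotWord {n : ℕ} (v : Fin (n + 1) → Fin d) :
    wordClass d v = (-1 : ℚ) ^ n • wordClass d (rotWord (n + 1) d v) := by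
  by_cases h : ∃ x : HCIndex d (n + 1) × ℕ,
      (rotWord (n + 1) d)^[x.2] (indexWord d x.1) = v
  · obtain ⟨⟨i, j⟩, rfl⟩ := h
    dsimp only
    rw [← Function.iterate_succ_apply' (rotWord (n + 1) d), wordClass_iterate, wordClass_iterate,
      smul_smul, ← pow_add, show n + n * (j + 1) = n * j + 2 * n by ring, pow_add, pow_mul _ 2]
    simp
  · rw [wordClass, dif_neg h, wordClass, dif_neg (fun h' => h (exists_of_rotWord d v h')), smul_zero]

open scoped Classical in
/-- The extension of `wordClass` to chains. -/
noncomputable def chainClass (n : ℕ) : Chain ℚ (TruncPoly ℚ d) n →ₗ[ℚ] HCSum d (n + 1) :=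
  (chainBasis d n).constr ℚ fun u =>
    if h : ∀ j, (u j).isSome then wordClass d fun j => (u j).get (h j) else 0

theorem chainClass_letterChain {n : ℕ} (v : Fin (n + 1) → Fin d) :
    chainClass d n (letterChain d v) = wordClass d v := by
  rw [letterChain, ← chainBasis_apply, chainClass, Module.Basis.constr_basis,
    dif_pos (fun j => Option.isSome_some)]
  rfl

open scoped Classical in
/-- The chain representing an element of the direct sum. -/
noncomputable def sumRep (n : ℕ) : HCSum d (n + 1) →ₗ[ℚ] Chain ℚ (TruncPoly ℚ d) n :=
  DirectSum.toModule ℚ _ _ fun m => DirectSum.toModule ℚ _ _ fun S =>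
    LinearMap.toSpanSingleton ℚ _ (letterChain d (indexWord d ⟨m, S⟩))

theorem sumRep_basisVec {n : ℕ} (i : HCIndex d (n + 1)) :
    sumRep d n (basisVec d i) = letterChain d (indexWord d i) := by
  rw [sumRep, basisVec, DirectSum.toModule_lof, DirectSum.toModule_lof,
    LinearMap.toSpanSingleton_apply, one_smul]

theorem HCSum_ext {w : ℕ} {M : Type*} [AddCommGroup M] [Module ℚ M] {f g : HCSum d w →ₗ[ℚ] M}
    (h : ∀ i, f (basisVec d i) = g (basisVec d i)) : f = g := by
  classical
  refine DirectSum.linearMap_ext ℚ fun m => DirectSum.linearMap_ext ℚ fun S =>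
    LinearMap.ext_ring ?_
  have h1 := h ⟨m, S⟩
  rw [basisVec] at h1
  simp only [LinearMap.comp_apply]
  convert h1

theorem chainClass_sumRep {n : ℕ} (x : HCSum d (n + 1)) : chainClass d n (sumRep d n x) = x := by
  suffices h : chainClass d n ∘ₗ sumRep d n = LinearMap.id from LinearMap.congr_fun h x
  refine HCSum_ext d fun i => ?_
  rw [LinearMap.comp_apply, sumRep_basisVec, chainClass_letterChain]
  have := wordClass_iterate d i 0
  simpa using this

theorem sumRep_mem {n : ℕ} (x : HCSum d (n + 1)) : sumRep d n x ∈ weightPart ℚ d (n + 1) n := by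
  have h : (weightPart ℚ d (n + 1) n).mkQ ∘ₗ sumRep d n = 0 := by
    refine HCSum_ext d fun i => ?_
    rw [LinearMap.comp_apply, sumRep_basisVec, LinearMap.zero_apply, Submodule.mkQ_apply,
      Submodule.Quotient.mk_eq_zero]
    exact letterChain_mem d _
  have h1 := LinearMap.congr_fun h x
  rwa [LinearMap.comp_apply, LinearMap.zero_apply, Submodule.mkQ_apply,
    Submodule.Quotient.mk_eq_zero] at h1

theorem chainClass_eq_zero_of_mem_tSpan {n : ℕ} {y : Chain ℚ (TruncPoly ℚ d) n}
    (hy : y ∈ tSpan d (n + 1) n) : chainClass d n y = 0 := by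
  obtain ⟨u, hu, rfl⟩ := hy
  refine (weightPart_top_le d fun v => ?_ :
    _ ≤ LinearMap.ker (chainClass d n ∘ₗ (1 - t ℚ (TruncPoly ℚ d) n))) hu
  rw [LinearMap.mem_ker, LinearMap.comp_apply, LinearMap.sub_apply, Module.End.one_apply,
    t_letterChain, map_sub, map_smul, chainClass_letterChain, chainClass_letterChain,
    ← wordClass_rotWord, sub_self]

/-- If the parity condition fails, `m` rotations return `v` with sign `-1`, so `2v` vanishes in the
coinvariants. -/
theorem letterChain_mem_tSpan_or {n : ℕ} (v : Fin (n + 1) → Fin d) :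
    letterChain d v ∈ tSpan d (n + 1) n ∨
      ∃ (i : HCIndex d (n + 1)) (j : ℕ), (rotWord (n + 1) d)^[j] (indexWord d i) = v := by
  obtain ⟨m, hm, S, j, hmw, rfl⟩ := exists_iterate_familyRep (Nat.add_one_pos n) v
  by_cases h : m ≡ n + 1 [MOD 2]
  · exact Or.inr ⟨⟨⟨m, hmw, h⟩, S⟩, j, rfl⟩
  · left
    set v := (rotWord (n + 1) d)^[j] (extendWord hm (n + 1) (familyRep S)) with hv
    have hper : (rotWord (n + 1) d)^[m] v = v := by
      rw [hv, ← Function.iterate_add_apply, Nat.add_comm m j, Function.iterate_add_apply,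
        iterate_extendWord hm hmw _ m, rotWord_iterate_self]
    have h1 := letterChain_sub_iterate_mem d v m
    -- The parities of `m` and `n + 1` differ, and an even `m` cannot divide an odd `n + 1`; so `m`
    -- and `n` are both odd.
    have hodd : Odd (n * m) := by
      rw [Nat.odd_mul, Nat.odd_iff, Nat.odd_iff]
      have h2 : ¬ m % 2 = (n + 1) % 2 := h
      have h3 : m % 2 = 1 ∨ n % 2 = 0 := by omega
      obtain ⟨k, hk⟩ := hmw
      by_contra hne
      have hm0 : m % 2 = 0 := by omega
      have : (n + 1) % 2 = 0 := by rw [hk, Nat.mul_mod, hm0, zero_mul, Nat.zero_mod]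
      omega
    rw [hper, hodd.neg_one_pow, neg_one_smul, sub_neg_eq_add, ← two_smul ℚ] at h1
    simpa using Submodule.smul_mem _ (2⁻¹ : ℚ) h1

theorem sub_sumRep_chainClass_mem {n : ℕ} {y : Chain ℚ (TruncPoly ℚ d) n}
    (hy : y ∈ weightPart ℚ d (n + 1) n) :
    y - sumRep d n (chainClass d n y) ∈ tSpan d (n + 1) n := by
  refine (weightPart_top_le d fun v => ?_ : _ ≤ (tSpan d (n + 1) n).comap
    (LinearMap.id - sumRep d n ∘ₗ chainClass d n)) hy
  rw [Submodule.mem_comap, LinearMap.sub_apply, LinearMap.id_apply, LinearMap.comp_apply]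
  rcases letterChain_mem_tSpan_or d v with h | ⟨i, j, rfl⟩
  · rw [chainClass_eq_zero_of_mem_tSpan d h, map_zero, sub_zero]
    exact h
  · rw [chainClass_letterChain, wordClass_iterate, map_smul, sumRep_basisVec]
    have h1 := Submodule.smul_mem _ (-(-1 : ℚ) ^ (n * j))
      (letterChain_sub_iterate_mem d (indexWord d i) j)
    convert h1 using 1
    rw [smul_sub, smul_smul, neg_mul, ← mul_pow]
    simp only [mul_neg, mul_one, neg_neg, one_pow, neg_smul, one_smul]
    abel

theorem nonempty_HC_equiv_sum (n : ℕ) :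
    Nonempty (HC ℚ d (n + 1) n ≃ₗ[ℚ] HCSum d (n + 1)) := by
  refine nonempty_HC_equiv_of_coinvariants d (chainClass d n)
    (fun y hy => chainClass_eq_zero_of_mem_tSpan d hy)
    (fun y hy => chainClass_eq_zero_of_mem_tSpan d (b_mem_tSpan_of_weight_eq d hy))
    (fun y hy _ h => ⟨0, Submodule.zero_mem _, ?_⟩)
    (fun x => ⟨sumRep d n x, sumRep_mem d x, ?_, chainClass_sumRep d x⟩)
  · have h1 := sub_sumRep_chainClass_mem d hy
    rwa [h, map_zero, sub_zero, ← sub_zero y, ← map_zero (b ℚ _ n)] at h1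
  · cases n with
    | zero => trivial
    | succ n =>
      have h1 := b_mem d (sumRep_mem d x)
      -- The boundary would have weight larger than its number of tensor factors, so it is zero.
      rw [weightPart_eq_bot d (by omega), Submodule.mem_bot] at h1
      rw [IsConnesCycle, h1]
      exact Submodule.zero_mem _

end PositiveWeight
end Tsygan

theorem mainTheorem7 (d : ℕ) :
    (∀ n : ℕ, Even n → Nonempty (Tsygan.HC ℚ d 0 n ≃ₗ[ℚ] ℚ)) ∧
    (∀ n : ℕ, ¬ Even n → Subsingleton (Tsygan.HC ℚ d 0 n)) ∧
    (∀ w n : ℕ, 0 < w → n + 1 = w →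
      Nonempty (Tsygan.HC ℚ d w n ≃ₗ[ℚ]
        ⨁ m : {m : ℕ // m ∣ w ∧ m ≡ w [MOD 2]}, ⨁ _ : Tsygan.omega m d, ℚ)) ∧
    (∀ w n : ℕ, 0 < w → n + 1 ≠ w → Subsingleton (Tsygan.HC ℚ d w n)) ∧
    (∀ m : ℕ, 0 < m → (Tsygan.omega m d).Finite ∧
      ((Tsygan.omega m d).ncard : ℚ) =
        (∑ i ∈ m.divisors, (ArithmeticFunction.moebius (m / i) : ℚ) * (d : ℚ) ^ i) / m) := by
  refine ⟨fun n hn => Tsygan.nonempty_HC_zero_equiv d hn,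
    fun n hn => Tsygan.subsingleton_HC_zero d hn, ?_,
    fun w n hw hn => Tsygan.subsingleton_HC_of_ne d hw hn,
    fun m hm => ⟨Set.toFinite _, Tsygan.ncard_omega hm⟩⟩
  rintro w n - rfl
  exact Tsygan.nonempty_HC_equiv_sum d n
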